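/- Let $R>0$. For $z\in\mathbb R^2\cong\mathbb C$ put $$\Psi_R(z)=\Big(\frac{2Rz}{1+R^2|z|^2},\frac{1-R^2|z|^2}{1+R^2|z|^2}\Big)\in S^2\subset\mathbb R^3,$$ let $B$ be the open unit disc, $S^2_R=\Psi_R(B)$ the spherical cap with closure $\overline{S^2_R}=\Psi_R(\overline B)$ and boundary circle $\partial S^2_R=\Psi_R(\partial B)$, and $\pi_R=\Psi_R^{-1}$. Let $g_{S^2}$ be the round metric, $\nu$ the outward unit normal of $S^2_R$ along $\partial S^2_R$, tangent to $S^2$, and $k_R=\frac{1-R^2}{2R}$ the geodesic curvature of $\partial S^2_R$ in the metric $g_{S^2}$. Let $M_R$ be the group of the maps $\Psi_R\circ\Phi\circ\pi_R$, where $\Phi(z)=e^{i\phi}\frac{z+a}{1+\bar a z}$ with $a\in\mathbb C$, $|a|<1$, $\phi\in\mathbb R$, and let $T_{id}M_R$ be its tangent space at the identity, that is, the set of vector fields $\bar\xi=\frac{\partial\Phi(t)}{\partial t}\big|_{t=0}$ on $\overline{S^2_R}$, where $(\Phi(t))_t$ is a family in $M_R$ that is differentiable at $t=0$ and has $\Phi(0)=id$.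 Let $g=e^{2u}g_{S^2}$ be any conformal metric on the cap, with $u\in C^3(\overline{S^2_R})$ (for instance $u$ smooth up to the boundary), with area element $d\mu_g=e^{2u}d\mu_{g_{S^2}}$, boundary line element $ds_g=e^{u}ds_{g_{S^2}}$, Gauss curvature $K$ and boundary geodesic curvature $k$, so that $$K=e^{-2u}\big(-\Delta_{g_{S^2}}u+1\big)\ \text{ in }S^2_R,\qquad k=e^{-u}\Big(\frac{\partial u}{\partial\nu}+k_R\Big)\ \text{ on }\partial S^2_R .$$ Then for every $\bar\xi\in T_{id}M_R$ there holds $$\frac12\int_{S^2_R}dK\cdot\bar\xi\,d\mu_g+\int_{\partial S^2_R}dk\cdot\bar\xi\,ds_g=0 .$$ -/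

import Mathlib

noncomputable section

namespace KazdanWarnerCap

/-- Euclidean 3-space, with coordinates `X 0, X 1, X 2`. -/
abbrev E3 : Type := EuclideanSpace ℝ (Fin 3)

/-! ### The spherical cap -/

/-- `Ψ_R(z) = Ψ(R z)`, the scaled inverse stereographic projection from the plane `ℂ` to the unit
sphere, with `0` going to the north pole. -/
def Psi (R : ℝ) (z : ℂ) : E3 :=
  !₂[2 * R * z.re / (1 + R ^ 2 * ‖z‖ ^ 2), 2 * R * z.im / (1 + R ^ 2 * ‖z‖ ^ 2),
    (1 - R ^ 2 * ‖z‖ ^ 2) / (1 + R ^ 2 * ‖z‖ ^ 2)]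

/-- The scaled stereographic projection `π_R = Ψ_R⁻¹`. -/
def stereo (R : ℝ) (X : E3) : ℂ :=
  ⟨X 0 / (R * (1 + X 2)), X 1 / (R * (1 + X 2))⟩

/-- The cap `S²_R`, boundary included: the image under `Ψ_R` of the closed unit disc. -/
def cap (R : ℝ) : Set E3 := Psi R '' Metric.closedBall 0 1

/-- The boundary circle of the cap. -/
def capBoundary (R : ℝ) : Set E3 := Psi R '' Metric.sphere 0 1

/-- `r = 2R/(1+R²)`, the Euclidean radius of the boundary circle. -/
def capRadius (R : ℝ) : ℝ := 2 * R / (1 + R ^ 2)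

/-- `σ = (1-R²)/(1+R²)`, the height of the boundary circle. -/
def capHeight (R : ℝ) : ℝ := (1 - R ^ 2) / (1 + R ^ 2)

/-- `k_R = σ/r`, the geodesic curvature of the boundary circle in the round metric. -/
def roundBoundaryCurvature (R : ℝ) : ℝ := capHeight R / capRadius R

/-- The outward unit normal of the cap along its boundary circle, tangent to the sphere:
`(σ z, -r)` at the point `(r z, σ)`, `|z| = 1`. -/
def outerNormal (R : ℝ) (X : E3) : E3 :=
  !₂[capHeight R * (X 0 / capRadius R), capHeight R * (X 1 / capRadius R), -capRadius R]

/-! ### Calculus on the cap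

For a function `f` on the cap, `df_X(v)` is `fderivWithin ℝ f (cap R) X v`. This is only used for
vectors `v` tangent to the sphere at `X`, where it does not depend on the choice of a derivative
within the cap. -/

/-- Orthogonal projection of `v` onto the tangent plane `X^⊥` of the unit sphere at `X`. -/
def tangentProj (X v : E3) : E3 := v - inner ℝ X v • X

/-- The gradient `∇f` in the round metric: the tangent vector field of `ℝ³` whose `i`-th component
is `df_X` applied to the tangential part of the `i`-th basis vector. -/
def capGrad (R : ℝ) (f : E3 → ℝ) (X : E3) : E3 :=
  ∑ i : Fin 3, fderivWithin ℝ f (cap R) X (tangentProj X (EuclideanSpace.single i 1)) •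
    EuclideanSpace.single i (1 : ℝ)

/-- The divergence of a tangential vector field in the round metric: the trace over the tangent
plane of the tangential derivative. -/
def capDiv (R : ℝ) (V : E3 → E3) (X : E3) : ℝ :=
  ∑ i : Fin 3, inner ℝ (EuclideanSpace.single i (1 : ℝ))
    (fderivWithin ℝ V (cap R) X (tangentProj X (EuclideanSpace.single i 1)))

/-- The Laplace–Beltrami operator `div ∇` of the round metric on the cap. -/
def capLaplacian (R : ℝ) (f : E3 → ℝ) (X : E3) : ℝ := capDiv R (capGrad R f) X

/-- The derivative of `f` in the direction of the outward normal, along the boundary circle. -/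
def normalDeriv (R : ℝ) (f : E3 → ℝ) (X : E3) : ℝ :=
  fderivWithin ℝ f (cap R) X (outerNormal R X)

/-! ### Integration on the cap -/

/-- The area element of `Ψ_R`: the square root of the Gram determinant of its partial
derivatives. -/
def areaElement (R : ℝ) (z : ℂ) : ℝ :=
  Real.sqrt (‖fderiv ℝ (Psi R) z 1‖ ^ 2 * ‖fderiv ℝ (Psi R) z Complex.I‖ ^ 2 -
    (inner ℝ (fderiv ℝ (Psi R) z 1) (fderiv ℝ (Psi R) z Complex.I)) ^ 2)

/-- The surface integral of `f` over the cap with respect to the round metric. -/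
def capIntegral (R : ℝ) (f : E3 → ℝ) : ℝ :=
  ∫ z in Metric.ball (0 : ℂ) 1, f (Psi R z) * areaElement R z

/-- The boundary circle, parametrized by the angle. -/
def boundaryCurve (R θ : ℝ) : E3 := Psi R (Complex.exp (θ * Complex.I))

/-- The line integral of `f` over the boundary circle with respect to round arc length. -/
def boundaryIntegral (R : ℝ) (f : E3 → ℝ) : ℝ :=
  ∫ θ in (0 : ℝ)..(2 * Real.pi), f (boundaryCurve R θ) * ‖deriv (boundaryCurve R) θ‖

/-! ### The conformal metric `g = e^{2u} g_{S²}` -/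

/-- Gauss curvature `K_g = e^{-2u} (-Δu + 1)` of `g = e^{2u} g_{S²}`. -/
def gaussCurvature (R : ℝ) (u : E3 → ℝ) (X : E3) : ℝ :=
  Real.exp (-2 * u X) * (-capLaplacian R u X + 1)

/-- Geodesic curvature `k_g = e^{-u} (∂u/∂ν + k_R)` of the boundary in `g = e^{2u} g_{S²}`. -/
def geodesicCurvature (R : ℝ) (u : E3 → ℝ) (X : E3) : ℝ :=
  Real.exp (-u X) * (normalDeriv R u X + roundBoundaryCurvature R)

/-- Integral over the cap with respect to the area `dμ_g = e^{2u} dμ_{g_{S²}}`. -/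
def capIntegralConf (R : ℝ) (u f : E3 → ℝ) : ℝ :=
  capIntegral R (fun X => f X * Real.exp (2 * u X))

/-- Integral over the boundary with respect to the arc length `ds_g = e^u ds_{g_{S²}}`. -/
def boundaryIntegralConf (R : ℝ) (u f : E3 → ℝ) : ℝ :=
  boundaryIntegral R (fun X => f X * Real.exp (u X))

/-! ### The conformal group of the cap -/

/-- The Möbius transformation `z ↦ e^{iφ} (z + a) / (1 + ā z)` of the disc. -/
def discMobius (a : ℂ) (φ : ℝ) (z : ℂ) : ℂ :=
  Complex.exp (φ * Complex.I) * ((z + a) / (1 + starRingEnd ℂ a * z))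

/-- `Φ ∈ M_R`: on the cap, `Φ = Ψ_R ∘ Φ₀ ∘ π_R` with a Möbius transformation `Φ₀` of the disc. -/
def IsCapMobius (R : ℝ) (Φ : E3 → E3) : Prop :=
  ∃ (a : ℂ) (φ : ℝ), ‖a‖ < 1 ∧ ∀ X ∈ cap R, Φ X = Psi R (discMobius a φ (stereo R X))

/-- `ξ ∈ T_id M_R`: `ξ` is the velocity at `t = 0` of a family of transformations in `M_R` that
passes through the identity at `t = 0`. -/
def IsInfinitesimalCapMobius (R : ℝ) (ξ : E3 → E3) : Prop :=
  ∃ Φ : ℝ → E3 → E3, (∀ t, IsCapMobius R (Φ t)) ∧ (∀ X ∈ cap R, Φ 0 X = X) ∧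
    ∀ X ∈ cap R, HasDerivAt (fun t => Φ t X) (ξ X) 0

end KazdanWarnerCap

end

/-! The identity is conformally natural, so it is proved on the flat disc and transferred. Under
`Psi R` the metric becomes $e^{2w}|dz|^2$ with $w=u\circ\Psi_R+\log\frac{2R}{1+R^2|z|^2}$. Its
curvatures are $K=-e^{-2w}\Delta w$ and $k=e^{-w}(\partial_r w+1)$, so $R$ disappears from the
problem. The elements of $T_{id}M_R$ become the fields $\eta=\alpha+i\beta z-\bar\alpha z^2$
(`IsInfinitesimalCapMobius.exists_discField`).

On the disc, $e^{2w}\,dK(\eta)=2\,\eta(w)\Delta w-\eta(\Delta w)$. This is a divergence, for two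
reasons: $D\eta$ is $\rho$ times the identity plus a rotation, and $\rho$ is affine, hence harmonic.
The divergence theorem leaves an integral over the circle (`integral_ball_pohozaev`). There $\eta$
is tangential with angular speed $\tau$, and $\tau'=\rho$. With $s=\partial_r w$ and $v=w$ on the
circle, adding the term in $dk$ turns the integrand into $(\tau(s-v))'$, whose integral over a
period vanishes (`kazdan_warner_disc`).

The transfer rests on `fderivWithin_image_Psi` and `fderivWithin_image_Psi_curve`, which compute
derivatives within a surface or a curve in space through the parametrization, and on
`gaussCurvature_Psi` and `geodesicCurvature_Psi`. Since $u$ is $C^3$ on the closed cap, $w$, its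
gradient and its Laplacian are all $C^1$ up to the boundary, which is exactly what the divergence
theorem needs. -/

namespace KazdanWarnerCap

open MeasureTheory Set Filter Topology

/-! ### Divergence theorem on the disc -/

/-- Integration over the unit disc in polar coordinates. -/
theorem setIntegral_ball_eq_polar (h : ℂ → ℝ) :
    ∫ z in Metric.ball (0 : ℂ) 1, h z =
      ∫ p in Ioo (0 : ℝ) 1 ×ˢ Ioo (-Real.pi) Real.pi, p.1 * h (Complex.polarCoord.symm p) := by
  rw [← integral_indicator Metric.isOpen_ball.measurableSet, ← Complex.integral_comp_polarCoord_symm,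
    ← integral_indicator (measurableSet_Ioo.prod measurableSet_Ioo), polarCoord_target,
    ← integral_indicator (measurableSet_Ioi.prod measurableSet_Ioo)]
  refine integral_congr_ae (Filter.Eventually.of_forall fun p => ?_)
  by_cases hp : p ∈ Ioi (0 : ℝ) ×ˢ Ioo (-Real.pi) Real.pi
  · have hp0 : 0 < p.1 := hp.1
    have hn : ‖Complex.polarCoord.symm p‖ = p.1 := by
      rw [Complex.norm_polarCoord_symm, abs_of_pos hp0]
    by_cases h1 : p.1 < 1
    · have hm : p ∈ Ioo (0 : ℝ) 1 ×ˢ Ioo (-Real.pi) Real.pi := ⟨⟨hp0, h1⟩, hp.2⟩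
      have hb : Complex.polarCoord.symm p ∈ Metric.ball (0 : ℂ) 1 := by
        rw [mem_ball_zero_iff, hn]; exact h1
      simp only [indicator_of_mem hp, indicator_of_mem hm, indicator_of_mem hb, smul_eq_mul]
    · have hm : p ∉ Ioo (0 : ℝ) 1 ×ˢ Ioo (-Real.pi) Real.pi := fun hm => h1 hm.1.2
      have hb : Complex.polarCoord.symm p ∉ Metric.ball (0 : ℂ) 1 := by
        rw [mem_ball_zero_iff, hn]; exact h1
      simp only [indicator_of_mem hp, indicator_of_notMem hm, indicator_of_notMem hb, smul_zero]
  · have hm : p ∉ Ioo (0 : ℝ) 1 ×ˢ Ioo (-Real.pi) Real.pi := fun hm => hp ⟨hm.1.1, hm.2⟩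
    simp only [indicator_of_notMem hp, indicator_of_notMem hm]

theorem hasFDerivAt_polarCoord_symm (p : ℝ × ℝ) :
    ∃ e : ℝ × ℝ →L[ℝ] ℂ, HasFDerivAt (fun p => Complex.polarCoord.symm p) e p ∧
      e (1, 0) = Real.cos p.2 + Real.sin p.2 * Complex.I ∧
      e (0, 1) = p.1 * (-Real.sin p.2 + Real.cos p.2 * Complex.I) := by
  have h1 : HasFDerivAt (fun p : ℝ × ℝ => p.1) (ContinuousLinearMap.fst ℝ ℝ ℝ) p := hasFDerivAt_fst
  have h2 : HasFDerivAt (fun p : ℝ × ℝ => p.2) (ContinuousLinearMap.snd ℝ ℝ ℝ) p := hasFDerivAt_snd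
  have ho : ∀ {f : ℝ × ℝ → ℝ} {f' : ℝ × ℝ →L[ℝ] ℝ}, HasFDerivAt f f' p →
      HasFDerivAt (fun p => (f p : ℂ)) (Complex.ofRealCLM.comp f') p := fun h =>
    Complex.ofRealCLM.hasFDerivAt.comp p h
  have h := (ho h1).mul ((ho h2.cos).add ((ho h2.sin).mul_const Complex.I))
  have heq : (fun p => Complex.polarCoord.symm p) = fun p : ℝ × ℝ =>
      (p.1 : ℂ) * (Real.cos p.2 + Real.sin p.2 * Complex.I) :=
    funext Complex.polarCoord_symm_apply
  rw [heq]
  refine ⟨_, h, ?_, ?_⟩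
  · simp
  · simp; ring

theorem clm_apply_eq (G : ℂ →L[ℝ] ℝ) (v : ℂ) : G v = v.re * G 1 + v.im * G Complex.I := by
  conv_lhs => rw [show v = v.re • (1 : ℂ) + v.im • Complex.I by simp]
  rw [map_add, map_smul, map_smul]; rfl

theorem uniqueDiffOn_closedBall_one : UniqueDiffOn ℝ (Metric.closedBall (0 : ℂ) 1) :=
  uniqueDiffOn_convex (convex_closedBall _ _)
    (by rw [interior_closedBall _ one_ne_zero]; exact Metric.nonempty_ball.2 one_pos)

/-- The divergence theorem on the unit disc, for fields that are `C¹` up to the boundary. -/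
theorem integral_ball_divergence {X Y : ℂ → ℝ} (hX : ContDiffOn ℝ 1 X (Metric.closedBall 0 1))
    (hY : ContDiffOn ℝ 1 Y (Metric.closedBall 0 1)) :
    ∫ z in Metric.ball (0 : ℂ) 1, (fderiv ℝ X z 1 + fderiv ℝ Y z Complex.I) =
      ∫ θ in (0 : ℝ)..(2 * Real.pi), (X (Complex.exp (θ * Complex.I)) * Real.cos θ +
        Y (Complex.exp (θ * Complex.I)) * Real.sin θ) := by
  have hper : Function.Periodic (fun θ : ℝ => X (Complex.exp (θ * Complex.I)) * Real.cos θ +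
      Y (Complex.exp (θ * Complex.I)) * Real.sin θ) (2 * Real.pi) := by
    intro θ
    have : Complex.exp (((θ + 2 * Real.pi : ℝ) : ℂ) * Complex.I) = Complex.exp (θ * Complex.I) := by
      push_cast; rw [add_mul, Complex.exp_periodic]
    simp only [this, Real.cos_add_two_pi, Real.sin_add_two_pi]
  -- The polar chart has angles in $(-\pi,\pi)$, so the boundary integral is moved to that period.
  have hshift := hper.intervalIntegral_add_eq 0 (-Real.pi)
  rw [zero_add, show -Real.pi + 2 * Real.pi = Real.pi by ring] at hshift
  rw [hshift]
  set e : ℝ × ℝ → ℂ := fun p => Complex.polarCoord.symm p with he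
  have hec : Continuous e := by
    rw [he]; simp only [Complex.polarCoord_symm_apply]; fun_prop
  have hpi : -Real.pi ≤ Real.pi := by linarith [Real.pi_pos]
  set Q : Set (ℝ × ℝ) := Icc (0 : ℝ) 1 ×ˢ Icc (-Real.pi) Real.pi with hQ
  set Q' : Set (ℝ × ℝ) := Ioo (0 : ℝ) 1 ×ˢ Ioo (-Real.pi) Real.pi with hQ'
  have hmap : MapsTo e Q (Metric.closedBall 0 1) := by
    intro p hp
    rw [mem_closedBall_zero_iff, he, Complex.norm_polarCoord_symm, abs_of_nonneg hp.1.1]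
    exact hp.1.2
  have hmap' : MapsTo e Q' (Metric.ball 0 1) := by
    intro p hp
    rw [mem_ball_zero_iff, he, Complex.norm_polarCoord_symm, abs_of_pos hp.1.1]
    exact hp.1.2
  have hnhds : ∀ z ∈ Metric.ball (0 : ℂ) 1, Metric.closedBall (0 : ℂ) 1 ∈ nhds z := fun z hz =>
    Filter.mem_of_superset (Metric.isOpen_ball.mem_nhds hz) Metric.ball_subset_closedBall
  have hdiff : ∀ {f : ℂ → ℝ}, ContDiffOn ℝ 1 f (Metric.closedBall 0 1) →
      ∀ z ∈ Metric.ball (0 : ℂ) 1, DifferentiableAt ℝ f z := fun hf z hz =>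
    (hf.differentiableOn one_ne_zero).differentiableAt (hnhds z hz)
  have hud : UniqueDiffOn ℝ (Metric.closedBall (0 : ℂ) 1) := uniqueDiffOn_closedBall_one
  -- `f` is $r$ times the radial component and `g` the angular component, so that $\partial_r
  -- f+\partial_\theta g=r\,\mathrm{div}(X,Y)$; the factor $r$ is the polar Jacobian.
  let f : ℝ × ℝ → ℝ := fun p => p.1 * (X (e p) * Real.cos p.2 + Y (e p) * Real.sin p.2)
  let g : ℝ × ℝ → ℝ := fun p => Y (e p) * Real.cos p.2 - X (e p) * Real.sin p.2
  have hXe : ContinuousOn (fun p => X (e p)) Q := hX.continuousOn.comp hec.continuousOn hmap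
  have hYe : ContinuousOn (fun p => Y (e p)) Q := hY.continuousOn.comp hec.continuousOn hmap
  have hcos : ContinuousOn (fun p : ℝ × ℝ => Real.cos p.2) Q := by fun_prop
  have hsin : ContinuousOn (fun p : ℝ × ℝ => Real.sin p.2) Q := by fun_prop
  have hfc : ContinuousOn f Q := continuousOn_fst.mul ((hXe.mul hcos).add (hYe.mul hsin))
  have hgc : ContinuousOn g Q := (hYe.mul hcos).sub (hXe.mul hsin)
  have hder : ∀ p ∈ Q', HasFDerivAt f (fderiv ℝ f p) p ∧ HasFDerivAt g (fderiv ℝ g p) p ∧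
      fderiv ℝ f p (1, 0) + fderiv ℝ g p (0, 1) =
        p.1 * (fderiv ℝ X (e p) 1 + fderiv ℝ Y (e p) Complex.I) := by
    intro p hp
    obtain ⟨e', hd, h10, h01⟩ := hasFDerivAt_polarCoord_symm p
    have h1 : HasFDerivAt (fun p : ℝ × ℝ => p.1) (ContinuousLinearMap.fst ℝ ℝ ℝ) p :=
      hasFDerivAt_fst
    have h2 : HasFDerivAt (fun p : ℝ × ℝ => p.2) (ContinuousLinearMap.snd ℝ ℝ ℝ) p :=
      hasFDerivAt_snd
    have hx : HasFDerivAt (fun p => X (e p)) _ p :=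
      HasFDerivAt.comp p (hdiff hX _ (hmap' hp)).hasFDerivAt hd
    have hy : HasFDerivAt (fun p => Y (e p)) _ p :=
      HasFDerivAt.comp p (hdiff hY _ (hmap' hp)).hasFDerivAt hd
    have hf : HasFDerivAt f _ p := h1.mul ((hx.mul h2.cos).add (hy.mul h2.sin))
    have hg : HasFDerivAt g _ p := (hy.mul h2.cos).sub (hx.mul h2.sin)
    refine ⟨hf.differentiableAt.hasFDerivAt, hg.differentiableAt.hasFDerivAt, ?_⟩
    rw [hf.fderiv, hg.fderiv]
    simp only [add_apply, smul_apply, FunLike.coe_sub, Pi.sub_apply,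
      ContinuousLinearMap.comp_apply, h10, h01, smul_eq_mul, ContinuousLinearMap.coe_fst',
      ContinuousLinearMap.coe_snd']
    rw [clm_apply_eq (fderiv ℝ X _) (_ + _), clm_apply_eq (fderiv ℝ Y _) (_ + _),
      clm_apply_eq (fderiv ℝ X _) (_ * _), clm_apply_eq (fderiv ℝ Y _) (_ * _)]
    simp only [Complex.add_re, Complex.add_im, Complex.mul_re, Complex.mul_im, Complex.ofReal_re,
      Complex.ofReal_im, Complex.I_re, Complex.I_im, Complex.neg_re, Complex.neg_im]
    linear_combination (p.1 * (fderiv ℝ X (e p) 1 + fderiv ℝ Y (e p) Complex.I)) *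
      Real.sin_sq_add_cos_sq p.2
  -- Inside the disc `fderiv` agrees with `fderivWithin` on the closed disc, which is continuous up
  -- to the boundary; integrability follows by compactness of the rectangle.
  have hint : IntegrableOn (fun p => fderiv ℝ f p (1, 0) + fderiv ℝ g p (0, 1)) Q' := by
    have hc : ContinuousOn (fun p => p.1 * (fderivWithin ℝ X (Metric.closedBall 0 1) (e p) 1 +
        fderivWithin ℝ Y (Metric.closedBall 0 1) (e p) Complex.I)) Q := by
      have hx : ContinuousOn (fun p => fderivWithin ℝ X (Metric.closedBall 0 1) (e p)) Q :=
        (hX.continuousOn_fderivWithin hud le_rfl).comp hec.continuousOn hmap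
      have hy : ContinuousOn (fun p => fderivWithin ℝ Y (Metric.closedBall 0 1) (e p)) Q :=
        (hY.continuousOn_fderivWithin hud le_rfl).comp hec.continuousOn hmap
      exact continuousOn_fst.mul ((hx.clm_apply continuousOn_const).add
        (hy.clm_apply continuousOn_const))
    have hi := (hc.integrableOn_compact (μ := volume) (isCompact_Icc.prod isCompact_Icc)).mono_set
      (prod_mono Ioo_subset_Icc_self Ioo_subset_Icc_self : Q' ⊆ Q)
    refine hi.congr_fun (fun p hp => ?_) (measurableSet_Ioo.prod measurableSet_Ioo)
    simp only [(hder p hp).2.2, fderivWithin_of_mem_nhds (hnhds _ (hmap' hp))]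
  have hae : (Q : Set (ℝ × ℝ)) =ᵐ[volume] Q' :=
    Measure.set_prod_ae_eq Ioo_ae_eq_Icc.symm Ioo_ae_eq_Icc.symm
  have key := integral2_divergence_prod_of_hasFDerivAt f g (fderiv ℝ f) (fderiv ℝ g)
    0 (-Real.pi) 1 Real.pi (by rwa [uIcc_of_le zero_le_one, uIcc_of_le hpi])
    (by rwa [uIcc_of_le zero_le_one, uIcc_of_le hpi])
    (by rw [min_eq_left zero_le_one, max_eq_right zero_le_one, min_eq_left hpi, max_eq_right hpi]
        exact fun p hp => (hder p hp).1)
    (by rw [min_eq_left zero_le_one, max_eq_right zero_le_one, min_eq_left hpi, max_eq_right hpi]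
        exact fun p hp => (hder p hp).2.1)
    (by rw [uIcc_of_le zero_le_one, uIcc_of_le hpi]; exact hint.congr_set_ae hae)
  have hlhs : (∫ x in (0 : ℝ)..1, ∫ y in (-Real.pi)..Real.pi,
      fderiv ℝ f (x, y) (1, 0) + fderiv ℝ g (x, y) (0, 1)) =
      ∫ z in Metric.ball (0 : ℂ) 1, (fderiv ℝ X z 1 + fderiv ℝ Y z Complex.I) := by
    rw [setIntegral_ball_eq_polar, intervalIntegral.integral_of_le zero_le_one,
      integral_Ioc_eq_integral_Ioo]
    simp only [intervalIntegral.integral_of_le hpi, integral_Ioc_eq_integral_Ioo]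
    rw [← setIntegral_congr_fun (measurableSet_Ioo.prod measurableSet_Ioo)
      (fun p hp => (hder p hp).2.2)]
    exact (setIntegral_prod (fun p => fderiv ℝ f p (1, 0) + fderiv ℝ g p (0, 1)) hint).symm
  rw [← hlhs, key]
  -- Of the four sides of the rectangle, $\theta=\pm\pi$ cancel and $r=0$ contributes nothing
  -- because of the factor $r$; only $r=1$ remains.
  have hg0 : ∀ x : ℝ, g (x, Real.pi) = g (x, -Real.pi) := by
    intro x
    have : e (x, Real.pi) = e (x, -Real.pi) := by
      simp only [he, Complex.polarCoord_symm_apply]; simp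
    simp only [g, this]; simp
  simp only [hg0, sub_self, zero_add]
  have hf0 : ∀ y : ℝ, f (0, y) = 0 := fun y => by simp [f]
  simp only [hf0, intervalIntegral.integral_zero, sub_zero]
  refine intervalIntegral.integral_congr fun θ _ => ?_
  have : e (1, θ) = Complex.exp (θ * Complex.I) := by
    simp only [he, Complex.polarCoord_symm_apply]
    rw [Complex.exp_mul_I]; simp
  simp only [f, this, one_mul]

/-! ### Conformal fields and the Pohozaev identity -/

/-- The holomorphic vector fields `α + iβz - ᾱz²`, which generate the Möbius group of the disc. -/
noncomputable def discField (α : ℂ) (β : ℝ) (z : ℂ) : ℂ :=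
  α + β * Complex.I * z - starRingEnd ℂ α * z ^ 2

/-- Half the divergence of `discField α β`. -/
noncomputable def discDilation (α z : ℂ) : ℝ := -2 * (α.re * z.re + α.im * z.im)

/-- The angular speed of `discField α β` on the unit circle, at the angle `θ`. -/
noncomputable def circleSpeed (α : ℂ) (β θ : ℝ) : ℝ := β + 2 * (α.im * Real.cos θ - α.re * Real.sin θ)

theorem discField_re (α : ℂ) (β : ℝ) (z : ℂ) : (discField α β z).re =
    α.re - β * z.im - α.re * (z.re ^ 2 - z.im ^ 2) - 2 * α.im * z.re * z.im := by
  simp [discField, pow_two]; ring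

theorem discField_im (α : ℂ) (β : ℝ) (z : ℂ) : (discField α β z).im =
    α.im + β * z.re + α.im * (z.re ^ 2 - z.im ^ 2) - 2 * α.re * z.re * z.im := by
  simp [discField, pow_two]; ring

theorem discField_exp (α : ℂ) (β θ : ℝ) : discField α β (Complex.exp (θ * Complex.I)) =
    circleSpeed α β θ • (Complex.exp (θ * Complex.I) * Complex.I) := by
  have h := Real.sin_sq_add_cos_sq θ
  apply Complex.ext
  · rw [discField_re]
    simp only [circleSpeed, Complex.real_smul, Complex.mul_re, Complex.mul_im, Complex.I_re,
      Complex.I_im, Complex.ofReal_re, Complex.ofReal_im, Complex.exp_ofReal_mul_I_re,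
      Complex.exp_ofReal_mul_I_im]
    linear_combination (-α.re) * h
  · rw [discField_im]
    simp only [circleSpeed, Complex.real_smul, Complex.mul_re, Complex.mul_im, Complex.I_re,
      Complex.I_im, Complex.ofReal_re, Complex.ofReal_im, Complex.exp_ofReal_mul_I_re,
      Complex.exp_ofReal_mul_I_im]
    linear_combination (-α.im) * h

theorem hasFDerivAt_re (z : ℂ) : HasFDerivAt (fun z : ℂ => z.re) Complex.reCLM z :=
  Complex.reCLM.hasFDerivAt

theorem hasFDerivAt_im (z : ℂ) : HasFDerivAt (fun z : ℂ => z.im) Complex.imCLM z :=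
  Complex.imCLM.hasFDerivAt

/-- Together with `hasFDerivAt_discField_im` these are the Cauchy–Riemann equations: equal diagonal
entries and opposite off-diagonal ones, so the symmetric part of the differential is scalar. -/
theorem hasFDerivAt_discField_re (α : ℂ) (β : ℝ) (z : ℂ) :
    HasFDerivAt (fun z => (discField α β z).re) (discDilation α z • Complex.reCLM +
      (-β + 2 * α.re * z.im - 2 * α.im * z.re) • Complex.imCLM) z := by
  simp only [discField_re]
  have hx := hasFDerivAt_re z
  have hy := hasFDerivAt_im z
  have h := ((hy.const_mul β).const_sub α.re).sub (((hx.pow 2).sub (hy.pow 2)).const_mul α.re) |>.sub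
    ((hx.const_mul (2 * α.im)).mul hy)
  refine h.congr_fderiv ?_
  ext v
  simp [discDilation]
  ring

theorem hasFDerivAt_discField_im (α : ℂ) (β : ℝ) (z : ℂ) :
    HasFDerivAt (fun z => (discField α β z).im) (discDilation α z • Complex.imCLM +
      (β - 2 * α.re * z.im + 2 * α.im * z.re) • Complex.reCLM) z := by
  simp only [discField_im]
  have hx := hasFDerivAt_re z
  have hy := hasFDerivAt_im z
  have h := ((hx.const_mul β).const_add α.im).add (((hx.pow 2).sub (hy.pow 2)).const_mul α.im) |>.sub
    ((hx.const_mul (2 * α.re)).mul hy)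
  refine h.congr_fderiv ?_
  ext v
  simp [discDilation]
  ring

theorem hasFDerivAt_discDilation (α z : ℂ) : HasFDerivAt (discDilation α)
    ((-2 : ℝ) • (α.re • Complex.reCLM + α.im • Complex.imCLM)) z :=
  (((hasFDerivAt_re z).const_mul α.re).add ((hasFDerivAt_im z).const_mul α.im)).const_mul (-2)

theorem contDiff_discField_re (α : ℂ) (β : ℝ) : ContDiff ℝ 1 (fun z => (discField α β z).re) := by
  simp only [discField_re]
  have hx : ContDiff ℝ 1 (fun z : ℂ => z.re) := Complex.reCLM.contDiff
  have hy : ContDiff ℝ 1 (fun z : ℂ => z.im) := Complex.imCLM.contDiff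
  fun_prop

theorem contDiff_discField_im (α : ℂ) (β : ℝ) : ContDiff ℝ 1 (fun z => (discField α β z).im) := by
  simp only [discField_im]
  have hx : ContDiff ℝ 1 (fun z : ℂ => z.re) := Complex.reCLM.contDiff
  have hy : ContDiff ℝ 1 (fun z : ℂ => z.im) := Complex.imCLM.contDiff
  fun_prop

theorem contDiff_discDilation (α : ℂ) : ContDiff ℝ 1 (discDilation α) := by
  unfold discDilation
  have hx : ContDiff ℝ 1 (fun z : ℂ => z.re) := Complex.reCLM.contDiff
  have hy : ContDiff ℝ 1 (fun z : ℂ => z.im) := Complex.imCLM.contDiff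
  fun_prop

/-- A Pohozaev identity on the disc for the conformal field `discField α β`. Here `(P, Q)` is the
gradient of `w` and `L` its Laplacian. -/
theorem integral_ball_pohozaev (α : ℂ) (β : ℝ) {w P Q L : ℂ → ℝ}
    (hw : ContDiffOn ℝ 1 w (Metric.closedBall 0 1)) (hP : ContDiffOn ℝ 1 P (Metric.closedBall 0 1))
    (hQ : ContDiffOn ℝ 1 Q (Metric.closedBall 0 1)) (hL : ContDiffOn ℝ 1 L (Metric.closedBall 0 1))
    (hgrad : ∀ z ∈ Metric.ball (0 : ℂ) 1,
      HasFDerivAt w (P z • Complex.reCLM + Q z • Complex.imCLM) z)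
    (hsymm : ∀ z ∈ Metric.ball (0 : ℂ) 1, fderiv ℝ P z Complex.I = fderiv ℝ Q z 1)
    (hlap : ∀ z ∈ Metric.ball (0 : ℂ) 1, L z = fderiv ℝ P z 1 + fderiv ℝ Q z Complex.I) :
    ∫ z in Metric.ball (0 : ℂ) 1,
        (2 * fderiv ℝ w z (discField α β z) * L z - fderiv ℝ L z (discField α β z)) =
      ∫ θ in (0 : ℝ)..(2 * Real.pi),
        2 * (discDilation α (Complex.exp (θ * Complex.I)) *
          (P (Complex.exp (θ * Complex.I)) * Real.cos θ +
            Q (Complex.exp (θ * Complex.I)) * Real.sin θ - w (Complex.exp (θ * Complex.I))) +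
        circleSpeed α β θ * (Q (Complex.exp (θ * Complex.I)) * Real.cos θ -
            P (Complex.exp (θ * Complex.I)) * Real.sin θ) *
          (P (Complex.exp (θ * Complex.I)) * Real.cos θ +
            Q (Complex.exp (θ * Complex.I)) * Real.sin θ)) := by
  have he1 := (contDiff_discField_re α β).contDiffOn (s := Metric.closedBall 0 1)
  have he2 := (contDiff_discField_im α β).contDiffOn (s := Metric.closedBall 0 1)
  have hρ := (contDiff_discDilation α).contDiffOn (s := Metric.closedBall 0 1)
  have hnhds : ∀ z ∈ Metric.ball (0 : ℂ) 1, Metric.closedBall (0 : ℂ) 1 ∈ nhds z := fun z hz =>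
    Filter.mem_of_superset (Metric.isOpen_ball.mem_nhds hz) Metric.ball_subset_closedBall
  have hdiff : ∀ {f : ℂ → ℝ}, ContDiffOn ℝ 1 f (Metric.closedBall 0 1) →
      ∀ z ∈ Metric.ball (0 : ℂ) 1, HasFDerivAt f (fderiv ℝ f z) z := fun hf z hz =>
    ((hf.differentiableOn one_ne_zero).differentiableAt (hnhds z hz)).hasFDerivAt
  -- With $\eta$ the conformal field and $\rho$ its dilation, $(X,Y)=2(\rho\nabla
  -- w-w\nabla\rho)+2\eta(w)\nabla w-|\nabla w|^2\eta-L\eta$, where $\nabla\rho=-2\alpha$. The first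
  -- bracket has divergence $2\rho L$, the next two terms together give $2\eta(w)L$, and the last
  -- gives $-\eta(L)-2\rho L$.
  let X : ℂ → ℝ := fun z => 2 * (discDilation α z * P z) + 4 * α.re * w z +
    2 * (((discField α β z).re * P z + (discField α β z).im * Q z) * P z) -
    (discField α β z).re * (P z * P z + Q z * Q z + L z)
  let Y : ℂ → ℝ := fun z => 2 * (discDilation α z * Q z) + 4 * α.im * w z +
    2 * (((discField α β z).re * P z + (discField α β z).im * Q z) * Q z) -
    (discField α β z).im * (P z * P z + Q z * Q z + L z)
  have hX : ContDiffOn ℝ 1 X (Metric.closedBall 0 1) :=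
    ((contDiffOn_const.mul (hρ.mul hP)).add (contDiffOn_const.mul hw)).add
      (contDiffOn_const.mul (((he1.mul hP).add (he2.mul hQ)).mul hP)) |>.sub
      (he1.mul (((hP.mul hP).add (hQ.mul hQ)).add hL))
  have hY : ContDiffOn ℝ 1 Y (Metric.closedBall 0 1) :=
    ((contDiffOn_const.mul (hρ.mul hQ)).add (contDiffOn_const.mul hw)).add
      (contDiffOn_const.mul (((he1.mul hP).add (he2.mul hQ)).mul hQ)) |>.sub
      (he2.mul (((hP.mul hP).add (hQ.mul hQ)).add hL))
  have hdiv : ∀ z ∈ Metric.ball (0 : ℂ) 1, fderiv ℝ X z 1 + fderiv ℝ Y z Complex.I =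
      2 * fderiv ℝ w z (discField α β z) * L z - fderiv ℝ L z (discField α β z) := by
    intro z hz
    have e1 := hasFDerivAt_discField_re α β z
    have e2 := hasFDerivAt_discField_im α β z
    have ρ := hasFDerivAt_discDilation α z
    have p := hdiff hP z hz
    have q := hdiff hQ z hz
    have l := hdiff hL z hz
    have w' := hgrad z hz
    have x : HasFDerivAt X _ z := (((ρ.mul p).const_mul 2).add (w'.const_mul (4 * α.re))).add
      ((((e1.mul p).add (e2.mul q)).mul p).const_mul 2) |>.sub
      (e1.mul (((p.mul p).add (q.mul q)).add l))
    have y : HasFDerivAt Y _ z := (((ρ.mul q).const_mul 2).add (w'.const_mul (4 * α.im))).add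
      ((((e1.mul p).add (e2.mul q)).mul q).const_mul 2) |>.sub
      (e2.mul (((p.mul p).add (q.mul q)).add l))
    rw [x.fderiv, y.fderiv, w'.fderiv, clm_apply_eq (fderiv ℝ L z) (discField α β z)]
    simp only [add_apply, smul_apply, FunLike.coe_sub, Pi.sub_apply,
      smul_eq_mul, Complex.reCLM_apply, Complex.imCLM_apply, Complex.one_re, Complex.one_im,
      Complex.I_re, Complex.I_im, hsymm z hz, hlap z hz, Pi.add_apply, Pi.mul_apply]
    ring
  rw [← setIntegral_congr_fun measurableSet_ball hdiv, integral_ball_divergence hX hY]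
  refine intervalIntegral.integral_congr fun θ _ => ?_
  -- Tangency of the field kills every multiple of $\eta\cdot n$ on the circle, and $\alpha\cdot
  -- n=-\rho/2$ there turns the $w\nabla\rho$ term into $-2\rho w$.
  have h1 : (discField α β (Complex.exp (θ * Complex.I))).re = -(circleSpeed α β θ * Real.sin θ) := by
    rw [discField_exp]; simp [Complex.exp_ofReal_mul_I_im]
  have h2 : (discField α β (Complex.exp (θ * Complex.I))).im = circleSpeed α β θ * Real.cos θ := by
    rw [discField_exp]; simp [Complex.exp_ofReal_mul_I_re]
  simp only [X, Y, h1, h2, discDilation, Complex.exp_ofReal_mul_I_im, Complex.exp_ofReal_mul_I_re]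
  ring

/-! ### The identity on the flat disc -/

theorem hasDerivAt_exp_mul_I (θ : ℝ) : HasDerivAt (fun θ : ℝ => Complex.exp (θ * Complex.I))
    (Complex.exp (θ * Complex.I) * Complex.I) θ := by
  have h := ((hasDerivAt_id θ).ofReal_comp.mul_const Complex.I).cexp
  simpa using h

theorem exp_mul_I_mem_sphere (θ : ℝ) :
    Complex.exp (θ * Complex.I) ∈ Metric.sphere (0 : ℂ) 1 := by
  rw [mem_sphere_zero_iff_norm, Complex.norm_exp_ofReal_mul_I]

theorem exp_mul_I_mem_closedBall (θ : ℝ) :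
    Complex.exp (θ * Complex.I) ∈ Metric.closedBall (0 : ℂ) 1 :=
  Metric.sphere_subset_closedBall (exp_mul_I_mem_sphere θ)

/-- The Kazdan–Warner identity of the unit disc, for the metric `e^{2w}|dz|²`. -/
theorem kazdan_warner_disc (α : ℂ) (β : ℝ) {w P Q L : ℂ → ℝ}
    (hw : ContDiffOn ℝ 1 w (Metric.closedBall 0 1)) (hP : ContDiffOn ℝ 1 P (Metric.closedBall 0 1))
    (hQ : ContDiffOn ℝ 1 Q (Metric.closedBall 0 1)) (hL : ContDiffOn ℝ 1 L (Metric.closedBall 0 1))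
    (hgrad : ∀ z ∈ Metric.closedBall (0 : ℂ) 1,
      HasFDerivWithinAt w (P z • Complex.reCLM + Q z • Complex.imCLM) (Metric.closedBall 0 1) z)
    (hsymm : ∀ z ∈ Metric.ball (0 : ℂ) 1, fderiv ℝ P z Complex.I = fderiv ℝ Q z 1)
    (hlap : ∀ z ∈ Metric.ball (0 : ℂ) 1, L z = fderiv ℝ P z 1 + fderiv ℝ Q z Complex.I) :
    (1 / 2) * (∫ z in Metric.ball (0 : ℂ) 1,
        (2 * fderiv ℝ w z (discField α β z) * L z - fderiv ℝ L z (discField α β z))) +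
      ∫ θ in (0 : ℝ)..(2 * Real.pi), circleSpeed α β θ *
        deriv (fun θ : ℝ => Real.exp (-w (Complex.exp (θ * Complex.I))) *
          (P (Complex.exp (θ * Complex.I)) * Real.cos θ +
            Q (Complex.exp (θ * Complex.I)) * Real.sin θ + 1)) θ *
        Real.exp (w (Complex.exp (θ * Complex.I))) = 0 := by
  have hnhds : ∀ z ∈ Metric.ball (0 : ℂ) 1, Metric.closedBall (0 : ℂ) 1 ∈ nhds z := fun z hz =>
    Filter.mem_of_superset (Metric.isOpen_ball.mem_nhds hz) Metric.ball_subset_closedBall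
  rw [integral_ball_pohozaev α β hw hP hQ hL
    (fun z hz => (hgrad z (Metric.ball_subset_closedBall hz)).hasFDerivAt (hnhds z hz)) hsymm hlap]
  have hexp : ContDiff ℝ 1 (fun θ : ℝ => Complex.exp (θ * Complex.I)) := by
    have : ContDiff ℝ 1 (fun θ : ℝ => (θ : ℂ)) := Complex.ofRealCLM.contDiff
    exact (this.mul contDiff_const).cexp
  have hcirc : ∀ {f : ℂ → ℝ}, ContDiffOn ℝ 1 f (Metric.closedBall 0 1) →
      ContDiff ℝ 1 (fun θ : ℝ => f (Complex.exp (θ * Complex.I))) := fun hf =>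
    hf.comp_contDiff hexp exp_mul_I_mem_closedBall
  -- On the circle: `v` is the trace of $w$, `s` its radial derivative and `t` its tangential
  -- derivative, so $v'=t$.
  let v : ℝ → ℝ := fun θ => w (Complex.exp (θ * Complex.I))
  let s : ℝ → ℝ := fun θ => P (Complex.exp (θ * Complex.I)) * Real.cos θ +
    Q (Complex.exp (θ * Complex.I)) * Real.sin θ
  let t : ℝ → ℝ := fun θ => Q (Complex.exp (θ * Complex.I)) * Real.cos θ -
    P (Complex.exp (θ * Complex.I)) * Real.sin θ
  have hv : ContDiff ℝ 1 v := hcirc hw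
  have hs : ContDiff ℝ 1 s := ((hcirc hP).mul Real.contDiff_cos).add
    ((hcirc hQ).mul Real.contDiff_sin)
  have ht : ContDiff ℝ 1 t := ((hcirc hQ).mul Real.contDiff_cos).sub
    ((hcirc hP).mul Real.contDiff_sin)
  have hv' : ∀ θ, HasDerivAt v (t θ) θ := by
    intro θ
    have h := (hgrad _ (exp_mul_I_mem_closedBall θ)).comp_hasDerivAt θ (hasDerivAt_exp_mul_I θ)
      (Filter.Eventually.of_forall exp_mul_I_mem_closedBall)
    refine h.congr_deriv ?_
    simp [t, Complex.exp_ofReal_mul_I_im, Complex.exp_ofReal_mul_I_re]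
    ring
  have hs' : ∀ θ, HasDerivAt s (deriv s θ) θ := fun θ =>
    (hs.differentiable one_ne_zero θ).hasDerivAt
  have hτ : ContDiff ℝ 1 (circleSpeed α β) := by
    unfold circleSpeed
    fun_prop
  have hτ' : ∀ θ : ℝ, HasDerivAt (circleSpeed α β)
      (discDilation α (Complex.exp (θ * Complex.I))) θ := by
    intro θ
    have h := ((((Real.hasDerivAt_cos θ).const_mul α.im).sub
      ((Real.hasDerivAt_sin θ).const_mul α.re)).const_mul 2).const_add β
    refine h.congr_deriv ?_
    simp only [discDilation, Complex.exp_ofReal_mul_I_im, Complex.exp_ofReal_mul_I_re]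
    ring
  have hκ : ∀ θ, deriv (fun θ => Real.exp (-v θ) * (s θ + 1)) θ * Real.exp (v θ) =
      deriv s θ - t θ * (s θ + 1) := by
    intro θ
    have h : HasDerivAt (fun θ => Real.exp (-v θ) * (s θ + 1)) _ θ :=
      ((hv' θ).neg.exp).mul ((hs' θ).add_const 1)
    have hE : Real.exp (-v θ) * Real.exp (v θ) = 1 := by rw [← Real.exp_add]; simp
    rw [h.deriv]
    simp only [Pi.neg_apply]
    linear_combination (deriv s θ - t θ * (s θ + 1)) * hE
  -- The primitive of the sum of both boundary integrands: $\rho(s-v)+\tau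
  -- ts+\tau(s'-t(s+1))=\tau'(s-v)+\tau(s'-t)$, the quadratic terms $\tau ts$ cancelling.
  have hF : ∀ θ : ℝ, HasDerivAt (fun θ => circleSpeed α β θ * (s θ - v θ))
      (discDilation α (Complex.exp (θ * Complex.I)) * (s θ - v θ) +
        circleSpeed α β θ * (deriv s θ - t θ)) θ := fun θ => (hτ' θ).mul ((hs' θ).sub (hv' θ))
  have hρc : Continuous (fun θ : ℝ => discDilation α (Complex.exp (θ * Complex.I))) :=
    (contDiff_discDilation α).continuous.comp hexp.continuous
  have hs'c : Continuous (deriv s) := hs.continuous_deriv le_rfl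
  have hsc := hs.continuous
  have hvc := hv.continuous
  have htc := ht.continuous
  have hτc := hτ.continuous
  have hftc := intervalIntegral.integral_eq_sub_of_hasDerivAt (a := 0) (b := 2 * Real.pi)
    (fun θ _ => hF θ) (Continuous.intervalIntegrable (by fun_prop) _ _)
  have hend : circleSpeed α β (2 * Real.pi) * (s (2 * Real.pi) - v (2 * Real.pi)) -
      circleSpeed α β 0 * (s 0 - v 0) = 0 := by
    have : Complex.exp (((2 * Real.pi : ℝ) : ℂ) * Complex.I) = Complex.exp ((0 : ℝ) * Complex.I) := by
      push_cast; rw [Complex.exp_two_pi_mul_I]; simp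
    simp only [s, v, circleSpeed, this]
    simp
  rw [hend] at hftc
  have hbdry : (∫ θ in (0 : ℝ)..(2 * Real.pi), circleSpeed α β θ *
      deriv (fun θ => Real.exp (-v θ) * (s θ + 1)) θ * Real.exp (v θ)) =
      ∫ θ in (0 : ℝ)..(2 * Real.pi), circleSpeed α β θ * (deriv s θ - t θ * (s θ + 1)) :=
    intervalIntegral.integral_congr fun θ _ => by
      simp only [mul_assoc, hκ]
  have hpoh : (∫ θ in (0 : ℝ)..(2 * Real.pi), (discDilation α (Complex.exp (θ * Complex.I)) *
      (s θ - v θ) + circleSpeed α β θ * t θ * s θ)) +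
      (∫ θ in (0 : ℝ)..(2 * Real.pi), circleSpeed α β θ * (deriv s θ - t θ * (s θ + 1))) = 0 := by
    rw [← intervalIntegral.integral_add (Continuous.intervalIntegrable (by fun_prop) _ _)
      (Continuous.intervalIntegrable (by fun_prop) _ _)]
    refine (intervalIntegral.integral_congr fun θ _ => ?_).trans hftc
    ring
  rw [intervalIntegral.integral_const_mul, ← mul_assoc, show (1 / 2 : ℝ) * 2 = 1 by norm_num, one_mul]
  exact (congrArg _ hbdry).trans hpoh

/-! ### Inverse stereographic projection -/

theorem den_pos (R : ℝ) (z : ℂ) : 0 < 1 + R ^ 2 * (z.re ^ 2 + z.im ^ 2) := by positivity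

theorem sq_norm_eq (z : ℂ) : ‖z‖ ^ 2 = z.re ^ 2 + z.im ^ 2 := by
  rw [Complex.sq_norm, Complex.normSq_apply]; ring

theorem Psi_zero (R : ℝ) (z : ℂ) :
    Psi R z 0 = 2 * R * z.re / (1 + R ^ 2 * (z.re ^ 2 + z.im ^ 2)) := by
  simp [Psi, sq_norm_eq]

theorem Psi_one (R : ℝ) (z : ℂ) :
    Psi R z 1 = 2 * R * z.im / (1 + R ^ 2 * (z.re ^ 2 + z.im ^ 2)) := by
  simp [Psi, sq_norm_eq]

theorem Psi_two (R : ℝ) (z : ℂ) :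
    Psi R z 2 = 2 / (1 + R ^ 2 * (z.re ^ 2 + z.im ^ 2)) - 1 := by
  have := (den_pos R z).ne'
  simp [Psi, sq_norm_eq]
  field_simp
  ring

theorem contDiff_Psi (R : ℝ) {n : WithTop ℕ∞} : ContDiff ℝ n (Psi R) := by
  have hx : ContDiff ℝ n (fun z : ℂ => z.re) := Complex.reCLM.contDiff
  have hy : ContDiff ℝ n (fun z : ℂ => z.im) := Complex.imCLM.contDiff
  have hp : ContDiff ℝ n (fun z : ℂ => 1 + R ^ 2 * (z.re ^ 2 + z.im ^ 2)) := by fun_prop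
  have hp0 : ∀ z : ℂ, 1 + R ^ 2 * (z.re ^ 2 + z.im ^ 2) ≠ 0 := fun z => (den_pos R z).ne'
  have h0 : ContDiff ℝ n (fun z => Psi R z 0) := by
    rw [show (fun z => Psi R z 0) = _ from funext (Psi_zero R)]
    exact (contDiff_const.mul hx).div hp hp0
  have h1 : ContDiff ℝ n (fun z => Psi R z 1) := by
    rw [show (fun z => Psi R z 1) = _ from funext (Psi_one R)]
    exact (contDiff_const.mul hy).div hp hp0
  have h2 : ContDiff ℝ n (fun z => Psi R z 2) := by
    rw [show (fun z => Psi R z 2) = _ from funext (Psi_two R)]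
    exact (contDiff_const.div hp hp0).sub contDiff_const
  rw [contDiff_euclidean]
  intro i
  fin_cases i
  exacts [h0, h1, h2]

theorem hasFDerivAt_Psi (R : ℝ) (z : ℂ) : HasFDerivAt (Psi R) (fderiv ℝ (Psi R) z) z :=
  ((contDiff_Psi R (n := 1)).differentiable one_ne_zero z).hasFDerivAt

theorem hasFDerivAt_den (R : ℝ) (z : ℂ) :
    HasFDerivAt (fun z : ℂ => 1 + R ^ 2 * (z.re ^ 2 + z.im ^ 2))
      ((2 * R ^ 2) • (z.re • Complex.reCLM + z.im • Complex.imCLM)) z := by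
  have h := ((((hasFDerivAt_re z).pow 2).add ((hasFDerivAt_im z).pow 2)).const_mul (R ^ 2)).const_add 1
  refine h.congr_fderiv ?_
  ext v
  simp
  ring

theorem HasFDerivAt.div_real {f g : ℂ → ℝ} {f' g' : ℂ →L[ℝ] ℝ} {z : ℂ} (hf : HasFDerivAt f f' z)
    (hg : HasFDerivAt g g' z) (h0 : g z ≠ 0) :
    HasFDerivAt (fun z => f z / g z) ((g z)⁻¹ • f' - (f z / g z ^ 2) • g') z := by
  have hinv : HasFDerivAt (fun z => (g z)⁻¹) (-(g z ^ 2)⁻¹ • g') z :=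
    (hasDerivAt_inv h0).comp_hasFDerivAt z hg
  simp only [div_eq_mul_inv]
  refine (hf.mul hinv).congr_fderiv ?_
  ext v
  simp
  ring

/-- The differential of the inverse stereographic projection. -/
theorem fderiv_Psi_apply (R : ℝ) (z v : ℂ) :
    fderiv ℝ (Psi R) z v =
      !₂[2 * R * v.re / (1 + R ^ 2 * (z.re ^ 2 + z.im ^ 2)) -
          4 * R ^ 3 * z.re * (z.re * v.re + z.im * v.im) /
            (1 + R ^ 2 * (z.re ^ 2 + z.im ^ 2)) ^ 2,
        2 * R * v.im / (1 + R ^ 2 * (z.re ^ 2 + z.im ^ 2)) -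
          4 * R ^ 3 * z.im * (z.re * v.re + z.im * v.im) /
            (1 + R ^ 2 * (z.re ^ 2 + z.im ^ 2)) ^ 2,
        -4 * R ^ 2 * (z.re * v.re + z.im * v.im) /
            (1 + R ^ 2 * (z.re ^ 2 + z.im ^ 2)) ^ 2] := by
  have hp0 := (den_pos R z).ne'
  have hd := hasFDerivAt_den R z
  have hcomp : ∀ i, HasFDerivAt (fun z => Psi R z i)
      ((EuclideanSpace.proj i : E3 →L[ℝ] ℝ).comp (fderiv ℝ (Psi R) z)) z := fun i =>
    (EuclideanSpace.proj i : E3 →L[ℝ] ℝ).hasFDerivAt.comp z (hasFDerivAt_Psi R z)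
  have key : ∀ i {f : ℂ → ℝ} {f' : ℂ →L[ℝ] ℝ}, (∀ z, Psi R z i = f z) → HasFDerivAt f f' z →
      fderiv ℝ (Psi R) z v i = f' v := by
    intro i f f' hf hf'
    have h := hcomp i
    rw [show (fun z => Psi R z i) = f from funext hf] at h
    rw [← h.unique hf']
    rfl
  ext i
  fin_cases i
  · refine (key 0 (Psi_zero R) (HasFDerivAt.div_real ((hasFDerivAt_re z).const_mul (2 * R)) hd hp0)).trans ?_
    simp
    field_simp
    ring
  · refine (key 1 (Psi_one R) (HasFDerivAt.div_real ((hasFDerivAt_im z).const_mul (2 * R)) hd hp0)).trans ?_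
    simp
    field_simp
    ring
  · refine (key 2 (Psi_two R) ((HasFDerivAt.div_real (hasFDerivAt_const (2 : ℝ) z) hd hp0).sub_const 1)).trans ?_
    simp
    field_simp
    ring

/-- Conformality of the projection; the area element and all lengths are read off from this factor.
-/
theorem inner_fderiv_Psi (R : ℝ) (z v w : ℂ) :
    inner ℝ (fderiv ℝ (Psi R) z v) (fderiv ℝ (Psi R) z w) =
      4 * R ^ 2 / (1 + R ^ 2 * (z.re ^ 2 + z.im ^ 2)) ^ 2 * (v.re * w.re + v.im * w.im) := by
  have hp0 := (den_pos R z).ne'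
  rw [fderiv_Psi_apply, fderiv_Psi_apply]
  simp only [PiLp.inner_apply, Fin.sum_univ_three]
  simp
  field_simp
  ring

theorem areaElement_eq (R : ℝ) (z : ℂ) :
    areaElement R z = 4 * R ^ 2 / (1 + R ^ 2 * (z.re ^ 2 + z.im ^ 2)) ^ 2 := by
  rw [areaElement, ← real_inner_self_eq_norm_sq, ← real_inner_self_eq_norm_sq]
  simp only [inner_fderiv_Psi]
  simp only [Complex.one_re, Complex.one_im, Complex.I_re, Complex.I_im]
  rw [show ∀ x : ℝ, x * (1 * 1 + 0 * 0) * (x * (0 * 0 + 1 * 1)) - (x * (1 * 0 + 0 * 1)) ^ 2 = x ^ 2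
    from fun x => by ring]
  exact Real.sqrt_sq (by positivity)

theorem norm_fderiv_Psi (R : ℝ) (hR : 0 < R) (z v : ℂ) :
    ‖fderiv ℝ (Psi R) z v‖ = 2 * R / (1 + R ^ 2 * (z.re ^ 2 + z.im ^ 2)) * ‖v‖ := by
  have hp0 := den_pos R z
  rw [← sq_eq_sq₀ (norm_nonneg _) (by positivity), ← real_inner_self_eq_norm_sq, inner_fderiv_Psi,
    mul_pow, sq_norm_eq, div_pow]
  ring

/-- The coordinates of the projections of the standard basis vectors onto the tangent planes. -/
noncomputable def basisField (R : ℝ) (i : Fin 3) (z : ℂ) : ℂ :=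
  ![(1 / (2 * R) : ℝ) - (R / 2 : ℝ) * z ^ 2,
    ((1 / (2 * R) : ℝ) + (R / 2 : ℝ) * z ^ 2) * Complex.I, -z] i

theorem tangentProj_Psi {R : ℝ} (hR : 0 < R) (z : ℂ) (i : Fin 3) :
    tangentProj (Psi R z) (EuclideanSpace.single i 1) =
      fderiv ℝ (Psi R) z (basisField R i z) := by
  have hp0 := (den_pos R z).ne'
  rw [fderiv_Psi_apply, tangentProj, EuclideanSpace.inner_single_right]
  ext j
  fin_cases i <;> fin_cases j <;>
    simp [basisField, Psi_zero, Psi_one, Psi_two, pow_two] <;> field_simp <;> ring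

theorem stereo_Psi {R : ℝ} (hR : 0 < R) (z : ℂ) : stereo R (Psi R z) = z := by
  have hp0 := (den_pos R z).ne'
  apply Complex.ext
  · simp only [stereo, Psi_zero, Psi_two]
    field_simp
    ring
  · simp only [stereo, Psi_one, Psi_two]
    field_simp
    ring

theorem differentiableAt_stereo {R : ℝ} (hR : 0 < R) (z : ℂ) :
    DifferentiableAt ℝ (stereo R) (Psi R z) := by
  have hp := den_pos R z
  have h0 : R * (1 + Psi R z 2) ≠ 0 := by
    rw [Psi_two, add_sub_cancel]; positivity
  have hX : ∀ i, DifferentiableAt ℝ (fun X : E3 => X i) (Psi R z) := fun i =>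
    (EuclideanSpace.proj i : E3 →L[ℝ] ℝ).differentiableAt
  have hd : DifferentiableAt ℝ (fun X : E3 => R * (1 + X 2)) (Psi R z) :=
    ((hX 2).const_add 1).const_mul R
  have h1 := (hX 0).fun_mul (hd.fun_inv h0)
  have h2 := (hX 1).fun_mul (hd.fun_inv h0)
  have h : DifferentiableAt ℝ (fun X : E3 => Complex.equivRealProdCLM.symm
      (X 0 / (R * (1 + X 2)), X 1 / (R * (1 + X 2)))) (Psi R z) :=
    Complex.equivRealProdCLM.symm.differentiableAt.comp (Psi R z) (h1.prodMk h2)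
  have heq : stereo R = fun X : E3 => Complex.equivRealProdCLM.symm
      (X 0 / (R * (1 + X 2)), X 1 / (R * (1 + X 2))) := by
    funext X
    apply Complex.ext <;> simp [stereo]
  rw [heq]
  exact h

/-! ### Derivatives within images of planar sets -/

section Transfer

variable {F : Type*} [NormedAddCommGroup F] [NormedSpace ℝ F] {R : ℝ} {f : E3 → F} {g : ℂ → F}
  {g' : ℂ →L[ℝ] F} {s : Set ℂ} {z : ℂ}

/-- On the image of `s` near `Psi R z`, `f` equals `g ∘ stereo R`, and `stereo R` is differentiable
in the ambient space at that point. -/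
theorem differentiableWithinAt_of_comp_Psi (hR : 0 < R) (hz : z ∈ s)
    (hg : HasFDerivWithinAt g g' s z) (hfg : ∀ᶠ w in 𝓝[s] z, f (Psi R w) = g w) :
    DifferentiableWithinAt ℝ f (Psi R '' s) (Psi R z) := by
  have hst := (differentiableAt_stereo hR z).differentiableWithinAt (s := Psi R '' s)
  have hmaps : MapsTo (stereo R) (Psi R '' s) s := by
    rintro _ ⟨w, hw, rfl⟩
    rwa [stereo_Psi hR]
  have hg1 : DifferentiableWithinAt ℝ g s (stereo R (Psi R z)) := by
    rw [stereo_Psi hR]; exact hg.differentiableWithinAt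
  have hcomp := hg1.comp (Psi R z) hst hmaps
  have htend : Tendsto (stereo R) (𝓝[Psi R '' s] (Psi R z)) (𝓝[s] z) := by
    have := hst.continuousWithinAt.tendsto_nhdsWithin hmaps
    rwa [stereo_Psi hR] at this
  refine hcomp.congr_of_eventuallyEq ?_ ?_
  · filter_upwards [htend.eventually hfg, self_mem_nhdsWithin] with X hX hXs
    obtain ⟨w, hw, rfl⟩ := hXs
    rw [stereo_Psi hR] at hX
    rw [Function.comp_apply, stereo_Psi hR, hX]
  · rw [Function.comp_apply, stereo_Psi hR]
    exact hfg.self_of_nhdsWithin hz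

/-- Derivatives within the image of `s` in the sphere are computed in the disc. -/
theorem fderivWithin_image_Psi (hR : 0 < R) (hz : z ∈ s) (hs : UniqueDiffWithinAt ℝ s z)
    (hg : HasFDerivWithinAt g g' s z) (hfg : ∀ᶠ w in 𝓝[s] z, f (Psi R w) = g w) (v : ℂ) :
    fderivWithin ℝ f (Psi R '' s) (Psi R z) (fderiv ℝ (Psi R) z v) = g' v := by
  have hf := (differentiableWithinAt_of_comp_Psi hR hz hg hfg).hasFDerivWithinAt
  have h1 := hf.comp z (hasFDerivAt_Psi R z).hasFDerivWithinAt (mapsTo_image _ _)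
  have h2 : HasFDerivWithinAt (f ∘ Psi R) g' s z :=
    hg.congr_of_eventuallyEq hfg (hfg.self_of_nhdsWithin hz)
  -- A surface in space has no unique derivative within it, so `fderivWithin` is an arbitrary
  -- choice. Composed with the differential of `Psi R` it is determined, by uniqueness in the plane.
  rw [← hs.eq h1 h2]
  rfl

/-- The version along a curve `γ` in `s`, for sets `s` without unique derivatives. -/
theorem fderivWithin_image_Psi_curve (hR : 0 < R) {γ : ℝ → ℂ} {v : ℂ} {θ : ℝ}
    (hγ : HasDerivAt γ v θ) (hγs : ∀ t, γ t ∈ s)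
    (hg : HasFDerivWithinAt g g' s (γ θ)) (hfg : ∀ w ∈ s, f (Psi R w) = g w) :
    fderivWithin ℝ f (Psi R '' s) (Psi R (γ θ)) (fderiv ℝ (Psi R) (γ θ) v) =
      deriv (fun t => g (γ t)) θ := by
  have hf := (differentiableWithinAt_of_comp_Psi hR (hγs θ) hg
    (eventually_nhdsWithin_of_forall hfg)).hasFDerivWithinAt
  have h1 := hf.comp_hasDerivAt (f := fun t => Psi R (γ t)) θ ((hasFDerivAt_Psi R (γ θ)).comp_hasDerivAt θ hγ)
    (Eventually.of_forall fun t => mem_image_of_mem _ (hγs t))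
  rw [← h1.deriv]
  exact congrArg (fun h => deriv h θ) (funext fun t => hfg _ (hγs t))

end Transfer

/-! ### Infinitesimal Möbius transformations -/

/-- The elements of `T_id M_R` are the push-forwards of the fields `discField α β`. -/
theorem IsInfinitesimalCapMobius.exists_discField {R : ℝ} (hR : 0 < R) {ξ : E3 → E3}
    (hξ : IsInfinitesimalCapMobius R ξ) : ∃ (α : ℂ) (β : ℝ), ∀ z ∈ Metric.closedBall (0 : ℂ) 1,
      ξ (Psi R z) = fderiv ℝ (Psi R) z (discField α β z) := by
  obtain ⟨Φ, hΦ, h0, hd⟩ := hξ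
  choose a φ ha hform using hΦ
  have hcap : ∀ z ∈ Metric.closedBall (0 : ℂ) 1, Psi R z ∈ cap R := fun z hz =>
    mem_image_of_mem _ hz
  have hΦZ : ∀ z ∈ Metric.closedBall (0 : ℂ) 1, ∀ t,
      Φ t (Psi R z) = Psi R (discMobius (a t) (φ t) z) := fun z hz t => by
    rw [hform t _ (hcap z hz), stereo_Psi hR]
  have hZ0 : ∀ z ∈ Metric.closedBall (0 : ℂ) 1, discMobius (a 0) (φ 0) z = z := fun z hz => by
    rw [← stereo_Psi hR (discMobius (a 0) (φ 0) z), ← hΦZ z hz, h0 _ (hcap z hz), stereo_Psi hR]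
  have hZd : ∀ z ∈ Metric.closedBall (0 : ℂ) 1,
      DifferentiableAt ℝ (fun t => discMobius (a t) (φ t) z) 0 := by
    intro z hz
    have h1 : DifferentiableAt ℝ (stereo R) (Φ 0 (Psi R z)) := by
      rw [h0 _ (hcap z hz)]; exact differentiableAt_stereo hR z
    have h2 := DifferentiableAt.comp (0 : ℝ) h1 (hd _ (hcap z hz)).differentiableAt
    refine h2.congr_of_eventuallyEq (Eventually.of_forall fun t => ?_)
    simp only [Function.comp_apply]
    rw [hΦZ z hz, stereo_Psi hR]
  have hξZ : ∀ z ∈ Metric.closedBall (0 : ℂ) 1, ∀ η,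
      HasDerivAt (fun t => discMobius (a t) (φ t) z) η 0 →
      ξ (Psi R z) = fderiv ℝ (Psi R) z η := by
    intro z hz η hη
    have hP : HasFDerivAt (Psi R) (fderiv ℝ (Psi R) z) (discMobius (a 0) (φ 0) z) := by
      rw [hZ0 z hz]; exact hasFDerivAt_Psi R z
    have h := hP.comp_hasDerivAt (0 : ℝ) hη
    exact (hd _ (hcap z hz)).unique
      (h.congr_of_eventuallyEq (Eventually.of_forall fun t => hΦZ z hz t))
  have m0 : (0 : ℂ) ∈ Metric.closedBall (0 : ℂ) 1 := by simp
  have m1 : (1 : ℂ) ∈ Metric.closedBall (0 : ℂ) 1 := by simp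
  -- No regularity of `a` and `φ` in $t$ is given (`φ` may jump by multiples of $2\pi$). It is
  -- recovered for $c=e^{i\varphi}$ and $b=ca$ from the images of the two points $0$ and $1$.
  set c : ℝ → ℂ := fun t => Complex.exp (φ t * Complex.I) with hc
  set b : ℝ → ℂ := fun t => discMobius (a t) (φ t) 0 with hb
  set f : ℝ → ℂ := fun t => discMobius (a t) (φ t) 1 with hf
  have hb' : ∀ t, b t = c t * a t := fun t => by simp [hb, hc, discMobius]
  have hcc : ∀ t, c t * starRingEnd ℂ (c t) = 1 := fun t => by
    rw [Complex.mul_conj, Complex.normSq_eq_norm_sq, hc, Complex.norm_exp_ofReal_mul_I]; simp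
  have hca : ∀ t, starRingEnd ℂ (a t) = c t * starRingEnd ℂ (b t) := fun t => by
    rw [hb', map_mul, ← mul_assoc, hcc, one_mul]
  have hZ : ∀ z t, discMobius (a t) (φ t) z =
      (c t * z + b t) / (1 + c t * starRingEnd ℂ (b t) * z) := fun z t => by
    rw [← hca, hb', discMobius, hc]; ring
  have hb0 : b 0 = 0 := hZ0 0 m0
  have hc0 : c 0 = 1 := by
    have h := hZ0 1 m1
    rw [hZ, hb0] at h
    simpa using h
  have hden : ∀ t, 1 + starRingEnd ℂ (a t) ≠ 0 := fun t h => by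
    have h1 : starRingEnd ℂ (a t) = -1 := by linear_combination h
    have h2 := congrArg norm h1
    rw [RCLike.norm_conj, norm_neg, norm_one] at h2
    exact (ha t).ne h2
  -- The equation for the image of $1$ solved for $c$; the factor beside $c$ equals $1$ at $t=0$, so
  -- $c$ inherits differentiability from `f` and `b`.
  have hcf : ∀ t, c t * (1 - f t * starRingEnd ℂ (b t)) = f t - b t := by
    intro t
    have h1 : f t * (1 + starRingEnd ℂ (a t)) = c t + b t := by
      rw [hf]
      simp only [hZ 1 t, mul_one, ← hca]
      exact div_mul_cancel₀ _ (hden t)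
    rw [hca] at h1
    linear_combination (-1 : ℂ) * h1
  have hbd := (hZd 0 m0).hasDerivAt
  have hfd := (hZd 1 m1).hasDerivAt
  set α : ℂ := deriv b 0 with hα
  have hbs : HasDerivAt (fun t => starRingEnd ℂ (b t)) (starRingEnd ℂ α) 0 := hbd.star
  have hbs0 : starRingEnd ℂ (b 0) = 0 := by rw [hb0, map_zero]
  have hqd : HasDerivAt (fun t => 1 - f t * starRingEnd ℂ (b t)) _ 0 := (hfd.mul hbs).const_sub 1
  have hq0 : 1 - f 0 * starRingEnd ℂ (b 0) ≠ 0 := by rw [hbs0]; simp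
  have hcd0 : DifferentiableAt ℝ c 0 := by
    have h1 : DifferentiableAt ℝ (fun t => (f t - b t) / (1 - f t * starRingEnd ℂ (b t))) 0 :=
      (hfd.sub hbd).differentiableAt.div hqd.differentiableAt hq0
    refine h1.congr_of_eventuallyEq ?_
    filter_upwards [hqd.continuousAt.eventually_ne hq0] with t ht
    rw [← hcf, mul_div_cancel_right₀ _ ht]
  have hcd := hcd0.hasDerivAt
  set γ : ℂ := deriv c 0 with hγ
  -- Differentiating $c\bar c=1$ at $c(0)=1$ shows that $c'(0)$ is purely imaginary.
  have hγre : γ = γ.im * Complex.I := by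
    have h1 : HasDerivAt (fun t => c t * starRingEnd ℂ (c t)) _ 0 := hcd.mul hcd.star
    rw [show (fun t => c t * starRingEnd ℂ (c t)) = fun _ => 1 from funext hcc] at h1
    have h2 := h1.unique (hasDerivAt_const (0 : ℝ) (1 : ℂ))
    simp only [hc0, one_mul] at h2
    have h3 := congrArg Complex.re h2
    simp at h3
    apply Complex.ext <;> simp
    linarith
  refine ⟨α, γ.im, fun z hz => hξZ z hz _ ?_⟩
  have hn : HasDerivAt (fun t => c t * z + b t) (γ * z + α) 0 := (hcd.mul_const z).add hbd
  have hm : HasDerivAt (fun t => 1 + c t * starRingEnd ℂ (b t) * z) _ 0 :=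
    ((hcd.mul hbs).mul_const z).const_add 1
  have hm0 : 1 + c 0 * starRingEnd ℂ (b 0) * z ≠ 0 := by rw [hbs0]; simp
  have h : HasDerivAt (fun t => (c t * z + b t) / (1 + c t * starRingEnd ℂ (b t) * z)) _ 0 :=
    hn.div hm hm0
  simp only [hZ]
  refine h.congr_deriv ?_
  rw [hbs0, hb0, hc0, discField, ← hγre]
  simp
  ring

/-! ### The round Laplacian in disc coordinates -/

/-- The derivative of `basisField`. -/
noncomputable def basisFieldDeriv (R : ℝ) (i : Fin 3) (z : ℂ) : ℂ :=
  ![-(R * z), R * z * Complex.I, -1] i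

theorem hasDerivAt_basisField (R : ℝ) (i : Fin 3) (z : ℂ) :
    HasDerivAt (basisField R i) (basisFieldDeriv R i z) z := by
  have hsq : HasDerivAt (fun z : ℂ => ((R / 2 : ℝ) : ℂ) * z ^ 2) (R * z) z := by
    refine ((hasDerivAt_pow 2 z).const_mul ((R / 2 : ℝ) : ℂ)).congr_deriv ?_
    push_cast; ring
  fin_cases i
  · exact hsq.const_sub _
  · exact (hsq.const_add _).mul_const _
  · exact (hasDerivAt_id z).neg

/-- The fields $b_i$ satisfy $\sum_i b_i^2=0$, and this is half the derivative of that relation. It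
removes the first-order terms from the Laplacian. -/
theorem sum_basisFieldDeriv_mul {R : ℝ} (hR : R ≠ 0) (z : ℂ) :
    ∑ i, basisFieldDeriv R i z * basisField R i z = 0 := by
  have : (R : ℂ) ≠ 0 := Complex.ofReal_ne_zero.2 hR
  simp only [Fin.sum_univ_three, basisField, basisFieldDeriv, Matrix.cons_val]
  push_cast
  field_simp
  linear_combination (R ^ 2 * z ^ 3 + z) * Complex.I_sq

theorem hasFDerivAt_basisField (R : ℝ) (i : Fin 3) (z : ℂ) :
    ∃ b : ℂ →L[ℝ] ℂ, HasFDerivAt (basisField R i) b z ∧ ∀ v, b v = basisFieldDeriv R i z * v :=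
  ⟨_, (hasDerivAt_basisField R i z).hasFDerivAt.restrictScalars ℝ, fun v => by simp [mul_comm]⟩

/-- By $\sum_i b_i^2=0$ the tensor $\sum_i b_i\otimes b_i$ is a multiple of the identity on
symmetric forms; the multiple is $\frac12\sum_i|b_i|^2$, the inverse of the conformal factor. -/
theorem sum_bilin_basisField {R : ℝ} (hR : R ≠ 0) (z : ℂ) (H : ℂ →L[ℝ] ℂ →L[ℝ] ℝ)
    (hH : H 1 Complex.I = H Complex.I 1) :
    ∑ i, H (basisField R i z) (basisField R i z) =
      (1 + R ^ 2 * (z.re ^ 2 + z.im ^ 2)) ^ 2 / (4 * R ^ 2) * (H 1 1 + H Complex.I Complex.I) := by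
  have hexp : ∀ v : ℂ, H v v = v.re ^ 2 * H 1 1 + 2 * v.re * v.im * H Complex.I 1 +
      v.im ^ 2 * H Complex.I Complex.I := by
    intro v
    have hv : v = v.re • (1 : ℂ) + v.im • Complex.I := by simp
    have h1 : H v v = H (v.re • (1 : ℂ) + v.im • Complex.I) (v.re • (1 : ℂ) + v.im • Complex.I) := by
      rw [← hv]
    rw [h1]
    simp only [map_add, map_smul, add_apply, smul_apply, smul_eq_mul, hH]
    ring
  rw [Fin.sum_univ_three, hexp (basisField R 0 z), hexp (basisField R 1 z), hexp (basisField R 2 z)]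
  simp only [basisField, Matrix.cons_val, pow_two z, Complex.sub_re,
    Complex.sub_im, Complex.add_re, Complex.add_im, Complex.mul_re, Complex.mul_im, Complex.neg_re,
    Complex.neg_im, Complex.ofReal_re, Complex.ofReal_im, Complex.I_re, Complex.I_im]
  field_simp
  ring

variable {R : ℝ} {u : E3 → ℝ}

theorem contDiffOn_comp_Psi (hu : ContDiffOn ℝ 3 u (cap R)) :
    ContDiffOn ℝ 3 (fun z => u (Psi R z)) (Metric.closedBall 0 1) :=
  hu.comp (contDiff_Psi R).contDiffOn (mapsTo_image _ _)

theorem fderivWithin_cap_Psi (hR : 0 < R) (hu : ContDiffOn ℝ 3 u (cap R)) {z : ℂ}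
    (hz : z ∈ Metric.closedBall (0 : ℂ) 1) (v : ℂ) :
    fderivWithin ℝ u (cap R) (Psi R z) (fderiv ℝ (Psi R) z v) =
      fderivWithin ℝ (fun z => u (Psi R z)) (Metric.closedBall 0 1) z v :=
  fderivWithin_image_Psi hR hz (uniqueDiffOn_closedBall_one z hz)
    ((contDiffOn_comp_Psi hu).differentiableOn three_ne_zero z hz).hasFDerivWithinAt
    (Eventually.of_forall fun _ => rfl) v

theorem capGrad_Psi (hR : 0 < R) (hu : ContDiffOn ℝ 3 u (cap R)) {z : ℂ}
    (hz : z ∈ Metric.closedBall (0 : ℂ) 1) :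
    capGrad R u (Psi R z) =
      ∑ i, fderivWithin ℝ (fun z => u (Psi R z)) (Metric.closedBall 0 1) z (basisField R i z) •
        EuclideanSpace.single i (1 : ℝ) := by
  simp only [capGrad, tangentProj_Psi hR, fderivWithin_cap_Psi hR hu hz]

theorem closedBall_mem_nhds {z : ℂ} (hz : z ∈ Metric.ball (0 : ℂ) 1) :
    Metric.closedBall (0 : ℂ) 1 ∈ 𝓝 z :=
  mem_of_superset (Metric.isOpen_ball.mem_nhds hz) Metric.ball_subset_closedBall

theorem fderiv_fderivWithin_symm {U : ℂ → ℝ} (hU : ContDiffOn ℝ 3 U (Metric.closedBall 0 1)) {z : ℂ}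
    (hz : z ∈ Metric.ball (0 : ℂ) 1) (v w : ℂ) :
    fderiv ℝ (fderivWithin ℝ U (Metric.closedBall 0 1)) z v w =
      fderiv ℝ (fderivWithin ℝ U (Metric.closedBall 0 1)) z w v := by
  have heq : fderivWithin ℝ U (Metric.closedBall 0 1) =ᶠ[𝓝 z] fderiv ℝ U := by
    filter_upwards [Metric.isOpen_ball.mem_nhds hz] with y hy
    exact fderivWithin_of_mem_nhds (closedBall_mem_nhds hy)
  rw [heq.fderiv_eq]
  have h3 : ContDiffAt ℝ 3 U z := hU.contDiffAt (closedBall_mem_nhds hz)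
  exact h3.isSymmSndFDerivAt (by rw [minSmoothness_of_isRCLikeNormedField]; norm_num) v w

theorem contDiffOn_fderivWithin_closedBall {F : Type*} [NormedAddCommGroup F] [NormedSpace ℝ F]
    {U : ℂ → F} {n m : WithTop ℕ∞} (hU : ContDiffOn ℝ n U (Metric.closedBall 0 1))
    (hmn : m + 1 ≤ n) :
    ContDiffOn ℝ m (fderivWithin ℝ U (Metric.closedBall 0 1)) (Metric.closedBall 0 1) :=
  hU.fderivWithin uniqueDiffOn_closedBall_one hmn

/-- The trace is $\sum_i D_{b_i}(dU(b_i))$ with $U=u\circ\Psi_R$. As $b_i$ is holomorphic, the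
product rule yields $dU(\sum_i b_i'b_i)=0$ plus the Hessian contracted with $\sum_i b_i\otimes b_i$.
-/
theorem capLaplacian_Psi (hR : 0 < R) (hu : ContDiffOn ℝ 3 u (cap R)) {z : ℂ}
    (hz : z ∈ Metric.ball (0 : ℂ) 1) {H : ℂ →L[ℝ] ℂ →L[ℝ] ℝ}
    (hH : H = fderiv ℝ (fderivWithin ℝ (fun z => u (Psi R z)) (Metric.closedBall 0 1)) z) :
    capLaplacian R u (Psi R z) =
      (1 + R ^ 2 * (z.re ^ 2 + z.im ^ 2)) ^ 2 / (4 * R ^ 2) * (H 1 1 + H Complex.I Complex.I) := by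
  have hU := contDiffOn_comp_Psi hu
  have hzc := Metric.ball_subset_closedBall hz
  set G := fderivWithin ℝ (fun z => u (Psi R z)) (Metric.closedBall 0 1) with hG
  have hGd : HasFDerivAt G H z := by
    rw [hH]
    exact (((contDiffOn_fderivWithin_closedBall hU (m := 2) (by norm_num)).differentiableOn
      two_ne_zero).differentiableAt (closedBall_mem_nhds hz)).hasFDerivAt
  choose b hb hbv using fun i => hasFDerivAt_basisField R i z
  have hg : HasFDerivAt (fun w => ∑ i, G w (basisField R i w) • EuclideanSpace.single i (1 : ℝ))
      (∑ i, ((G z).comp (b i) + H.flip (basisField R i z)).smulRight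
        (EuclideanSpace.single i (1 : ℝ))) z :=
    HasFDerivAt.fun_sum fun i _ => (hGd.clm_apply (hb i)).smul_const _
  have hcomp : ∀ i, inner ℝ (EuclideanSpace.single i (1 : ℝ))
      (fderivWithin ℝ (capGrad R u) (cap R) (Psi R z)
        (tangentProj (Psi R z) (EuclideanSpace.single i 1))) =
      G z (basisFieldDeriv R i z * basisField R i z) +
        H (basisField R i z) (basisField R i z) := by
    intro i
    rw [tangentProj_Psi hR, cap, fderivWithin_image_Psi hR hzc (uniqueDiffOn_closedBall_one z hzc)
      hg.hasFDerivWithinAt (eventually_nhdsWithin_of_forall fun w hw => capGrad_Psi hR hu hw),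
      EuclideanSpace.inner_single_left]
    fin_cases i <;> simp [Fin.sum_univ_three, hbv]
  rw [capLaplacian, capDiv]
  simp only [hcomp]
  rw [Finset.sum_add_distrib, ← map_sum, sum_basisFieldDeriv_mul hR.ne', map_zero, zero_add,
    sum_bilin_basisField hR.ne' z H (by rw [hH]; exact fderiv_fderivWithin_symm hU hz _ _)]

/-! ### Normal and arc length of the boundary circle -/

/-- On $|z|=1$ the differential of `Psi R` stretches by $2R/(1+R^2)$, so the unit normal comes from
the radial vector of reciprocal length. -/
theorem outerNormal_Psi (hR : 0 < R) {z : ℂ} (hz : z ∈ Metric.sphere (0 : ℂ) 1) :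
    outerNormal R (Psi R z) = fderiv ℝ (Psi R) z (((1 + R ^ 2) / (2 * R)) • z) := by
  have h1 : z.re ^ 2 + z.im ^ 2 = 1 := by
    rw [← sq_norm_eq, mem_sphere_zero_iff_norm.1 hz, one_pow]
  have h2 : z.re * ((1 + R ^ 2) / (2 * R) * z.re) + z.im * ((1 + R ^ 2) / (2 * R) * z.im) =
      (1 + R ^ 2) / (2 * R) := by linear_combination (1 + R ^ 2) / (2 * R) * h1
  have hp : 1 + R ^ 2 ≠ 0 := by positivity
  rw [fderiv_Psi_apply, outerNormal]
  simp only [Psi_zero, Psi_one, Complex.smul_re, Complex.smul_im, smul_eq_mul, h1, h2, mul_one,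
    capHeight, capRadius]
  ext i
  fin_cases i <;> simp <;> field_simp <;> ring

theorem deriv_boundaryCurve (R θ : ℝ) : deriv (boundaryCurve R) θ =
    fderiv ℝ (Psi R) (Complex.exp (θ * Complex.I)) (Complex.exp (θ * Complex.I) * Complex.I) :=
  ((hasFDerivAt_Psi R _).comp_hasDerivAt θ (hasDerivAt_exp_mul_I θ)).deriv

theorem re_sq_add_im_sq_exp (θ : ℝ) : (Complex.exp (θ * Complex.I)).re ^ 2 +
    (Complex.exp (θ * Complex.I)).im ^ 2 = 1 := by
  rw [← sq_norm_eq, Complex.norm_exp_ofReal_mul_I, one_pow]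

theorem norm_deriv_boundaryCurve (hR : 0 < R) (θ : ℝ) :
    ‖deriv (boundaryCurve R) θ‖ = 2 * R / (1 + R ^ 2) := by
  rw [deriv_boundaryCurve, norm_fderiv_Psi R hR, re_sq_add_im_sq_exp, norm_mul,
    Complex.norm_exp_ofReal_mul_I, Complex.norm_I]
  simp

/-! ### The conformal exponent on the disc -/

/-- The logarithm `w` of the conformal factor of `g` in the disc, `g = e^{2w}|dz|²`. -/
noncomputable def discExponent (R : ℝ) (u : E3 → ℝ) (z : ℂ) : ℝ :=
  u (Psi R z) - Real.log (1 + R ^ 2 * (z.re ^ 2 + z.im ^ 2)) + Real.log (2 * R)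

/-- `∂w/∂x`. -/
noncomputable def discExponentX (R : ℝ) (u : E3 → ℝ) (z : ℂ) : ℝ :=
  fderivWithin ℝ (fun z => u (Psi R z)) (Metric.closedBall 0 1) z 1 -
    2 * R ^ 2 * z.re / (1 + R ^ 2 * (z.re ^ 2 + z.im ^ 2))

/-- `∂w/∂y`. -/
noncomputable def discExponentY (R : ℝ) (u : E3 → ℝ) (z : ℂ) : ℝ :=
  fderivWithin ℝ (fun z => u (Psi R z)) (Metric.closedBall 0 1) z Complex.I -
    2 * R ^ 2 * z.im / (1 + R ^ 2 * (z.re ^ 2 + z.im ^ 2))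

/-- The Laplacian of `w`. -/
noncomputable def discExponentLaplacian (R : ℝ) (u : E3 → ℝ) (z : ℂ) : ℝ :=
  fderivWithin ℝ (fderivWithin ℝ (fun z => u (Psi R z)) (Metric.closedBall 0 1))
      (Metric.closedBall 0 1) z 1 1 +
    fderivWithin ℝ (fderivWithin ℝ (fun z => u (Psi R z)) (Metric.closedBall 0 1))
      (Metric.closedBall 0 1) z Complex.I Complex.I -
    4 * R ^ 2 / (1 + R ^ 2 * (z.re ^ 2 + z.im ^ 2)) ^ 2

theorem exp_discExponent (hR : 0 < R) (z : ℂ) : Real.exp (discExponent R u z) =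
    Real.exp (u (Psi R z)) * (2 * R / (1 + R ^ 2 * (z.re ^ 2 + z.im ^ 2))) := by
  rw [discExponent, Real.exp_add, Real.exp_sub, Real.exp_log (den_pos R z),
    Real.exp_log (by positivity)]
  ring

section Regularity

theorem contDiff_re {n : WithTop ℕ∞} : ContDiff ℝ n (fun z : ℂ => z.re) := Complex.reCLM.contDiff

theorem contDiff_im {n : WithTop ℕ∞} : ContDiff ℝ n (fun z : ℂ => z.im) := Complex.imCLM.contDiff

theorem contDiff_den (R : ℝ) {n : WithTop ℕ∞} :
    ContDiff ℝ n (fun z : ℂ => 1 + R ^ 2 * (z.re ^ 2 + z.im ^ 2)) :=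
  contDiff_const.add (contDiff_const.mul ((contDiff_re.pow 2).add (contDiff_im.pow 2)))

theorem contDiffOn_discExponent (hu : ContDiffOn ℝ 3 u (cap R)) :
    ContDiffOn ℝ 1 (discExponent R u) (Metric.closedBall 0 1) :=
  (((contDiffOn_comp_Psi hu).of_le (by norm_num)).sub
    ((contDiff_den R).log fun z => (den_pos R z).ne').contDiffOn).add contDiffOn_const

theorem contDiffOn_discExponentX (hu : ContDiffOn ℝ 3 u (cap R)) :
    ContDiffOn ℝ 1 (discExponentX R u) (Metric.closedBall 0 1) :=
  ((contDiffOn_fderivWithin_closedBall (contDiffOn_comp_Psi hu) (by norm_num)).clm_apply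
    contDiffOn_const).sub ((contDiff_const.mul contDiff_re).div (contDiff_den R)
      fun z => (den_pos R z).ne').contDiffOn

theorem contDiffOn_discExponentY (hu : ContDiffOn ℝ 3 u (cap R)) :
    ContDiffOn ℝ 1 (discExponentY R u) (Metric.closedBall 0 1) :=
  ((contDiffOn_fderivWithin_closedBall (contDiffOn_comp_Psi hu) (by norm_num)).clm_apply
    contDiffOn_const).sub ((contDiff_const.mul contDiff_im).div (contDiff_den R)
      fun z => (den_pos R z).ne').contDiffOn

theorem contDiffOn_discExponentLaplacian (hu : ContDiffOn ℝ 3 u (cap R)) :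
    ContDiffOn ℝ 1 (discExponentLaplacian R u) (Metric.closedBall 0 1) := by
  have hH := contDiffOn_fderivWithin_closedBall (m := 1)
    (contDiffOn_fderivWithin_closedBall (m := 2) (contDiffOn_comp_Psi hu) (by norm_num))
    (by norm_num)
  exact (((hH.clm_apply contDiffOn_const).clm_apply contDiffOn_const).add
    ((hH.clm_apply contDiffOn_const).clm_apply contDiffOn_const)).sub
    (contDiff_const.div ((contDiff_den R).pow 2)
      fun z => pow_ne_zero 2 (den_pos R z).ne').contDiffOn

end Regularity

theorem hasFDerivWithinAt_discExponent (hu : ContDiffOn ℝ 3 u (cap R)) {z : ℂ}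
    (hz : z ∈ Metric.closedBall (0 : ℂ) 1) :
    HasFDerivWithinAt (discExponent R u)
      (discExponentX R u z • Complex.reCLM + discExponentY R u z • Complex.imCLM)
      (Metric.closedBall 0 1) z := by
  have h1 := ((contDiffOn_comp_Psi hu).differentiableOn three_ne_zero z hz).hasFDerivWithinAt
  have h2 := ((hasFDerivAt_den R z).log (den_pos R z).ne').hasFDerivWithinAt
    (s := Metric.closedBall 0 1)
  refine ((h1.sub h2).add_const (Real.log (2 * R))).congr_fderiv ?_
  ext v
  set G := fderivWithin ℝ (fun z => u (Psi R z)) (Metric.closedBall 0 1) z with hG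
  simp only [FunLike.coe_sub, Pi.sub_apply, add_apply, smul_apply, smul_eq_mul,
    Complex.reCLM_apply, Complex.imCLM_apply, discExponentX, discExponentY, ← hG, clm_apply_eq G v]
  ring

theorem fderiv_discExponentXY (hu : ContDiffOn ℝ 3 u (cap R)) {z : ℂ}
    (hz : z ∈ Metric.ball (0 : ℂ) 1) {H : ℂ →L[ℝ] ℂ →L[ℝ] ℝ}
    (hH : H = fderiv ℝ (fderivWithin ℝ (fun z => u (Psi R z)) (Metric.closedBall 0 1)) z) (v : ℂ) :
    fderiv ℝ (discExponentX R u) z v = H v 1 -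
        2 * R ^ 2 * (v.re / (1 + R ^ 2 * (z.re ^ 2 + z.im ^ 2)) -
          2 * R ^ 2 * z.re * (z.re * v.re + z.im * v.im) /
            (1 + R ^ 2 * (z.re ^ 2 + z.im ^ 2)) ^ 2) ∧
      fderiv ℝ (discExponentY R u) z v = H v Complex.I -
        2 * R ^ 2 * (v.im / (1 + R ^ 2 * (z.re ^ 2 + z.im ^ 2)) -
          2 * R ^ 2 * z.im * (z.re * v.re + z.im * v.im) /
            (1 + R ^ 2 * (z.re ^ 2 + z.im ^ 2)) ^ 2) := by
  have hGd : HasFDerivAt (fderivWithin ℝ (fun z => u (Psi R z)) (Metric.closedBall 0 1)) H z := by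
    rw [hH]
    exact (((contDiffOn_fderivWithin_closedBall (contDiffOn_comp_Psi hu) (m := 2)
      (by norm_num)).differentiableOn two_ne_zero).differentiableAt
      (closedBall_mem_nhds hz)).hasFDerivAt
  have hd := hasFDerivAt_den R z
  have hp0 := (den_pos R z).ne'
  have hX : HasFDerivAt (discExponentX R u) _ z := (hGd.clm_apply (hasFDerivAt_const 1 z)).sub
    (HasFDerivAt.div_real ((hasFDerivAt_re z).const_mul (2 * R ^ 2)) hd hp0)
  have hY : HasFDerivAt (discExponentY R u) _ z :=
    (hGd.clm_apply (hasFDerivAt_const Complex.I z)).sub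
    (HasFDerivAt.div_real ((hasFDerivAt_im z).const_mul (2 * R ^ 2)) hd hp0)
  constructor
  · rw [hX.fderiv]
    simp
    ring
  · rw [hY.fderiv]
    simp
    ring

theorem fderiv_discExponent_symm (hu : ContDiffOn ℝ 3 u (cap R)) {z : ℂ}
    (hz : z ∈ Metric.ball (0 : ℂ) 1) :
    fderiv ℝ (discExponentX R u) z Complex.I = fderiv ℝ (discExponentY R u) z 1 := by
  rw [(fderiv_discExponentXY hu hz rfl _).1, (fderiv_discExponentXY hu hz rfl _).2,
    fderiv_fderivWithin_symm (contDiffOn_comp_Psi hu) hz]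
  simp only [Complex.I_re, Complex.I_im, Complex.one_re, Complex.one_im]
  ring

theorem discExponentLaplacian_eq (hu : ContDiffOn ℝ 3 u (cap R)) {z : ℂ}
    (hz : z ∈ Metric.ball (0 : ℂ) 1) : discExponentLaplacian R u z =
      fderiv ℝ (discExponentX R u) z 1 + fderiv ℝ (discExponentY R u) z Complex.I := by
  have hp0 := (den_pos R z).ne'
  rw [(fderiv_discExponentXY hu hz rfl _).1, (fderiv_discExponentXY hu hz rfl _).2,
    discExponentLaplacian, fderivWithin_of_mem_nhds (closedBall_mem_nhds hz)]
  simp only [Complex.I_re, Complex.I_im, Complex.one_re, Complex.one_im]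
  field_simp
  ring

/-! ### Curvatures and their differentials in disc coordinates -/

/-- The flat Laplacian of $-\log(1+R^2|z|^2)$ is minus the round area density, which accounts for
the $+1$ in $K$. -/
theorem gaussCurvature_Psi (hR : 0 < R) (hu : ContDiffOn ℝ 3 u (cap R)) {z : ℂ}
    (hz : z ∈ Metric.ball (0 : ℂ) 1) : gaussCurvature R u (Psi R z) =
      -(Real.exp (-2 * discExponent R u z) * discExponentLaplacian R u z) := by
  have hp0 := (den_pos R z).ne'
  have hE := (Real.exp_pos (u (Psi R z))).ne'
  have h1 : ∀ x : ℝ, Real.exp (-2 * x) = (Real.exp x ^ 2)⁻¹ := fun x => by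
    rw [← Real.exp_nat_mul, ← Real.exp_neg]; congr 1; push_cast; ring
  rw [gaussCurvature, capLaplacian_Psi hR hu hz rfl, discExponentLaplacian,
    fderivWithin_of_mem_nhds (closedBall_mem_nhds hz), h1, h1, exp_discExponent hR]
  field_simp
  ring

/-- The logarithm contributes $-2R^2/(1+R^2)$ to the radial derivative; with the $1$ of the flat
circle this is $(1-R^2)/(1+R^2)$, and rescaling the normal gives $k_R$. -/
theorem geodesicCurvature_Psi (hR : 0 < R) (hu : ContDiffOn ℝ 3 u (cap R)) {z : ℂ}
    (hz : z ∈ Metric.sphere (0 : ℂ) 1) : geodesicCurvature R u (Psi R z) =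
      Real.exp (-discExponent R u z) *
        (discExponentX R u z * z.re + discExponentY R u z * z.im + 1) := by
  have h1 : z.re ^ 2 + z.im ^ 2 = 1 := by
    rw [← sq_norm_eq, mem_sphere_zero_iff_norm.1 hz, one_pow]
  have hp : 1 + R ^ 2 ≠ 0 := by positivity
  have hE := (Real.exp_pos (u (Psi R z))).ne'
  have hzv : fderivWithin ℝ (fun z => u (Psi R z)) (Metric.closedBall 0 1) z
      (((1 + R ^ 2) / (2 * R)) • z) = (1 + R ^ 2) / (2 * R) *
      (z.re * fderivWithin ℝ (fun z => u (Psi R z)) (Metric.closedBall 0 1) z 1 +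
        z.im * fderivWithin ℝ (fun z => u (Psi R z)) (Metric.closedBall 0 1) z Complex.I) := by
    rw [map_smul, clm_apply_eq, smul_eq_mul]
  rw [geodesicCurvature, normalDeriv, outerNormal_Psi hR hz,
    fderivWithin_cap_Psi hR hu (Metric.sphere_subset_closedBall hz), hzv, Real.exp_neg,
    Real.exp_neg, exp_discExponent hR, discExponentX, discExponentY, h1, roundBoundaryCurvature,
    capHeight, capRadius, mul_one]
  field_simp
  linear_combination (2 * R ^ 2) * h1

theorem fderivWithin_gaussCurvature (hR : 0 < R) (hu : ContDiffOn ℝ 3 u (cap R)) {z : ℂ}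
    (hz : z ∈ Metric.ball (0 : ℂ) 1) (v : ℂ) :
    fderivWithin ℝ (gaussCurvature R u) (cap R) (Psi R z) (fderiv ℝ (Psi R) z v) =
      Real.exp (-2 * discExponent R u z) *
        (2 * fderiv ℝ (discExponent R u) z v * discExponentLaplacian R u z -
          fderiv ℝ (discExponentLaplacian R u) z v) := by
  have hzc := Metric.ball_subset_closedBall hz
  have hw := (((contDiffOn_discExponent hu).differentiableOn one_ne_zero).differentiableAt
    (closedBall_mem_nhds hz)).hasFDerivAt
  have hL := (((contDiffOn_discExponentLaplacian hu).differentiableOn one_ne_zero).differentiableAt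
    (closedBall_mem_nhds hz)).hasFDerivAt
  have hg : HasFDerivAt (fun z => -(Real.exp (-2 * discExponent R u z) *
    discExponentLaplacian R u z)) _ z := ((hw.const_mul (-2)).exp.mul hL).neg
  rw [cap, fderivWithin_image_Psi hR hzc (uniqueDiffOn_closedBall_one z hzc) hg.hasFDerivWithinAt
    (by filter_upwards [mem_nhdsWithin_of_mem_nhds (Metric.isOpen_ball.mem_nhds hz)] with w hw
        exact gaussCurvature_Psi hR hu hw)]
  simp only [neg_apply, add_apply, smul_apply, smul_eq_mul]
  ring

/-- The disc formula for $k$ holds only on the circle, but its right-hand side is $C^1$ on the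
closed disc. This provides the differentiability that `fderivWithin_image_Psi_curve` asks for. -/
theorem fderivWithin_geodesicCurvature (hR : 0 < R) (hu : ContDiffOn ℝ 3 u (cap R)) (θ : ℝ) :
    fderivWithin ℝ (geodesicCurvature R u) (capBoundary R) (Psi R (Complex.exp (θ * Complex.I)))
        (fderiv ℝ (Psi R) (Complex.exp (θ * Complex.I))
          (Complex.exp (θ * Complex.I) * Complex.I)) =
      deriv (fun θ : ℝ => Real.exp (-discExponent R u (Complex.exp (θ * Complex.I))) *
        (discExponentX R u (Complex.exp (θ * Complex.I)) * Real.cos θ +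
          discExponentY R u (Complex.exp (θ * Complex.I)) * Real.sin θ + 1)) θ := by
  have hg : ContDiffOn ℝ 1 (fun z => Real.exp (-discExponent R u z) *
      (discExponentX R u z * z.re + discExponentY R u z * z.im + 1)) (Metric.closedBall 0 1) :=
    (contDiffOn_discExponent hu).neg.exp.mul
      ((((contDiffOn_discExponentX hu).mul contDiff_re.contDiffOn).add
        ((contDiffOn_discExponentY hu).mul contDiff_im.contDiffOn)).add contDiffOn_const)
  have hgd := ((hg.differentiableOn one_ne_zero _
    (exp_mul_I_mem_closedBall θ)).mono Metric.sphere_subset_closedBall).hasFDerivWithinAt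
  have h := fderivWithin_image_Psi_curve (f := geodesicCurvature R u) hR (hasDerivAt_exp_mul_I θ)
    exp_mul_I_mem_sphere hgd fun w hw => geodesicCurvature_Psi hR hu hw
  simp only [Complex.exp_ofReal_mul_I_re, Complex.exp_ofReal_mul_I_im] at h
  exact h

end KazdanWarnerCap

/-! ### Transfer of the identity to the cap -/

theorem lemma5p5 (R : ℝ) (hR : 0 < R) (u : KazdanWarnerCap.E3 → ℝ)
    (hu : ContDiffOn ℝ 3 u (KazdanWarnerCap.cap R))
    (ξ : KazdanWarnerCap.E3 → KazdanWarnerCap.E3)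
    (hξ : KazdanWarnerCap.IsInfinitesimalCapMobius R ξ) :
    (1 / 2 : ℝ) * KazdanWarnerCap.capIntegralConf R u
        (fun X => fderivWithin ℝ (KazdanWarnerCap.gaussCurvature R u)
          (KazdanWarnerCap.cap R) X (ξ X)) +
      KazdanWarnerCap.boundaryIntegralConf R u
        (fun X => fderivWithin ℝ (KazdanWarnerCap.geodesicCurvature R u)
          (KazdanWarnerCap.capBoundary R) X (ξ X)) = 0 := by
  open KazdanWarnerCap in
  obtain ⟨α, β, hαβ⟩ := hξ.exists_discField hR
  have hmain := kazdan_warner_disc α β (contDiffOn_discExponent hu) (contDiffOn_discExponentX hu)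
    (contDiffOn_discExponentY hu) (contDiffOn_discExponentLaplacian hu)
    (fun z hz => hasFDerivWithinAt_discExponent hu hz) (fun z hz => fderiv_discExponent_symm hu hz)
    (fun z hz => discExponentLaplacian_eq hu hz)
  rw [← hmain]
  congr 2
  · refine MeasureTheory.setIntegral_congr_fun measurableSet_ball fun z hz => ?_
    -- The area density of $g$ is $e^{2w}$, which cancels the factor $e^{-2w}$ in $dK$.
    have h1 : Real.exp (2 * u (Psi R z)) * areaElement R z =
        Real.exp (2 * discExponent R u z) := by
      have h2 : ∀ x : ℝ, Real.exp (2 * x) = Real.exp x ^ 2 := fun x => by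
        rw [← Real.exp_nat_mul]; norm_num
      rw [h2, h2, exp_discExponent hR, areaElement_eq, mul_pow, div_pow]
      ring
    have h3 : Real.exp (-2 * discExponent R u z) * Real.exp (2 * discExponent R u z) = 1 := by
      rw [← Real.exp_add]; simp
    simp only
    rw [hαβ z (Metric.ball_subset_closedBall hz), fderivWithin_gaussCurvature hR hu hz, mul_assoc,
      h1]
    linear_combination (2 * fderiv ℝ (discExponent R u) z (discField α β z) *
      discExponentLaplacian R u z - fderiv ℝ (discExponentLaplacian R u) z (discField α β z)) * h3
  · refine intervalIntegral.integral_congr fun θ _ => ?_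
    have h1 : Real.exp (u (boundaryCurve R θ)) * ‖deriv (boundaryCurve R) θ‖ =
        Real.exp (discExponent R u (Complex.exp (θ * Complex.I))) := by
      rw [exp_discExponent hR, norm_deriv_boundaryCurve hR, re_sq_add_im_sq_exp, mul_one]
      rfl
    simp only
    rw [mul_assoc, h1]
    -- On the circle the field is `circleSpeed` times the unit tangent $ie^{i\theta}$; linearity
    -- pulls this scalar out of both differentials.
    rw [boundaryCurve, hαβ _ (exp_mul_I_mem_closedBall θ), discField_exp, map_smul, map_smul,
      fderivWithin_geodesicCurvature hR hu, smul_eq_mul]
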